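/- Let $\mathcal H$ be a complex separable Hilbert space and write $\Re T=(T+T^*)/2$, $\Im T=(T-T^*)/(2i)$ for $T\in\mathcal B(\mathcal H)$. For $T\in\mathcal B(\mathcal H)$ with $\Im T\ge 0$ and $T^{-1}\in\mathcal B(\mathcal H)$ put $$\log T=-i\int_0^\infty \big((T+is)^{-1}-(1+is)^{-1}I\big)\,ds,\qquad \Xi(T)=\pi^{-1}\,\Im(\log T).$$ Let $M:\mathbb C_+\to\mathcal B(\mathcal H)$ be an operator-valued Herglotz function, i.e. $M$ is analytic and $\Im M(z)\ge 0$ for all $z$ in the open upper half-plane $\mathbb C_+$, and suppose that $M(z_0)^{-1}\in\mathcal B(\mathcal H)$ for some $z_0\in\mathbb C_+$. (i) Then $M(z)^{-1}\in\mathcal B(\mathcal H)$ for all $z\in\mathbb C_+$. (ii) There is a family $\{\widehat\Xi(\lambda)\}_{\lambda\in\mathbb R}$ of bounded self-adjoint operators, weakly Lebesgue measurable, with $0\le\widehat\Xi(\lambda)\le I$ for a.e. $\lambda\in\mathbb R$, such that $$\log M(z)=C+\int_{\mathbb R}\widehat\Xi(\lambda)\Big(\frac1{\lambda-z}-\frac{\lambda}{1+\lambda^2}\Big)\,d\lambda,\qquad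 z\in\mathbb C_+,$$ the integral being taken in the weak sense, where $C=C^*=\Re(\log M(i))$. (iii) Let $\{\widehat\Xi(\lambda)\}$ be any family as in (ii), and let $\Lambda\subseteq\mathbb R$ be Lebesgue measurable with $|\Lambda|\ne 0$, such that for a.e. $\lambda\in\Lambda$ the norm limit $M(\lambda+i0)=\lim_{\varepsilon\downarrow0}M(\lambda+i\varepsilon)$ exists in $\mathcal B(\mathcal H)$, $\Im M(\lambda+i0)\ge0$, and $M(\lambda+i0)^{-1}\in\mathcal B(\mathcal H)$. Then $$\widehat\Xi(\lambda)=\Xi(M(\lambda+i0))\quad\text{for a.e. }\lambda\in\Lambda .$$ Moreover, for a.e. $\lambda\in\Lambda$ this operator is also $P_{\mathcal H}E_L((-\infty,0))|_{\mathcal H}$ for every self-adjoint dilation $L$ of $T=M(\lambda+i0)$ in a Hilbert space $\mathcal K\supseteq\mathcal H$ (that is, $P_{\mathcal H}(L-z)^{-1}|_{\mathcal H}=(T-z)^{-1}$ whenever $\Im z<0$), where $E_L$ is the spectral measure of $L$. -/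

import Mathlib

open MeasureTheory Filter Topology
open scoped ComplexStarModule InnerProductSpace

/-- An operator-valued Herglotz function: `M` is (norm) analytic in the open upper half-plane and
`Im (M z) = (M z - (M z)*) / (2 i)` is nonnegative there. Only the values on the upper half-plane
matter. -/
structure IsOperatorHerglotz {H : Type*} [NormedAddCommGroup H] [InnerProductSpace ℂ H]
    [CompleteSpace H] (M : ℂ → H →L[ℂ] H) : Prop where
  differentiableOn : DifferentiableOn ℂ M {z : ℂ | 0 < z.im}
  im_nonneg : ∀ z : ℂ, 0 < z.im → 0 ≤ (ℑ (M z) : H →L[ℂ] H)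

/-- The logarithm of a bounded, boundedly invertible dissipative operator,
`log T = -i ∫₀^∞ ((T + i s)⁻¹ - (1 + i s)⁻¹ I) ds`.
For such `T` the integrand is norm continuous on `[0, ∞)` and of order `s⁻²` at infinity, so that
the norm convergent improper integral is a Bochner integral. -/
noncomputable def operatorLog {H : Type*} [NormedAddCommGroup H] [InnerProductSpace ℂ H]
    [CompleteSpace H] (T : H →L[ℂ] H) : H →L[ℂ] H :=
  (-Complex.I) • ∫ s in Set.Ioi (0 : ℝ),
    (Ring.inverse (T + (Complex.I * (s : ℂ)) • (1 : H →L[ℂ] H))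
      - ((1 + Complex.I * (s : ℂ))⁻¹) • (1 : H →L[ℂ] H))

/-- The spectral shift operator `Ξ(T) = π⁻¹ Im (log T)` of a bounded, boundedly invertible
dissipative operator. -/
noncomputable def operatorXi {H : Type*} [NormedAddCommGroup H] [InnerProductSpace ℂ H]
    [CompleteSpace H] (T : H →L[ℂ] H) : H →L[ℂ] H :=
  (Real.pi⁻¹ : ℝ) • (ℑ (operatorLog T) : H →L[ℂ] H)

/-- A projection-valued measure on the Borel sets of `ℝ`, i.e. the spectral family
`E = E_L` of a (possibly unbounded) self-adjoint operator `L = ∫ t dE(t)` in `K`.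
The values on non-measurable sets are irrelevant. -/
structure SpectralFamily (K : Type*) [NormedAddCommGroup K] [InnerProductSpace ℂ K]
    [CompleteSpace K] where
  proj : Set ℝ → K →L[ℂ] K
  isStarProjection : ∀ s, MeasurableSet s → IsStarProjection (proj s)
  univ : proj Set.univ = 1
  inter : ∀ s t, MeasurableSet s → MeasurableSet t → proj (s ∩ t) = proj s * proj t
  hasSum_iUnion : ∀ s : ℕ → Set ℝ, (∀ n, MeasurableSet (s n)) →
    Pairwise (Function.onFun Disjoint s) →
    ∀ x : K, HasSum (fun n => proj (s n) x) (proj (⋃ n, s n) x)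

namespace SpectralFamily

variable {K : Type*} [NormedAddCommGroup K] [InnerProductSpace ℂ K] [CompleteSpace K]

theorem proj_empty (E : SpectralFamily K) (x : K) : E.proj ∅ x = 0 := by
  have h := E.hasSum_iUnion (fun _ => ∅) (fun _ => MeasurableSet.empty)
    (fun _ _ _ => disjoint_bot_left) x
  exact tendsto_nhds_unique tendsto_const_nhds h.summable.tendsto_atTop_zero

theorem re_inner_proj_nonneg (E : SpectralFamily K) (x : K) (s : Set ℝ) (hs : MeasurableSet s) :
    0 ≤ (⟪x, E.proj s x⟫_ℂ).re := by
  have h := E.isStarProjection s hs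
  have h1 : E.proj s x = E.proj s (E.proj s x) := by
    conv_lhs => rw [← h.isIdempotentElem.eq]
    rfl
  have h2 : ⟪x, E.proj s (E.proj s x)⟫_ℂ = ⟪E.proj s x, E.proj s x⟫_ℂ := by
    rw [← ContinuousLinearMap.adjoint_inner_left,
      ContinuousLinearMap.isSelfAdjoint_iff'.mp h.isSelfAdjoint]
  rw [h1, h2]
  exact inner_self_nonneg (𝕜 := ℂ)

/-- The scalar spectral measure `s ↦ ⟪x, E(s) x⟫`. -/
noncomputable def measure (E : SpectralFamily K) (x : K) : Measure ℝ :=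
  Measure.ofMeasurable (fun s _ => ENNReal.ofReal (⟪x, E.proj s x⟫_ℂ).re)
    (by simp [E.proj_empty])
    (by
      intro f hf hd
      have h := E.hasSum_iUnion f hf hd x
      have h2 : HasSum (fun n => (⟪x, E.proj (f n) x⟫_ℂ).re)
          (⟪x, E.proj (⋃ n, f n) x⟫_ℂ).re :=
        Complex.hasSum_re ((innerSL ℂ x).hasSum h)
      rw [← h2.tsum_eq, ENNReal.ofReal_tsum_of_nonneg
        (fun n => E.re_inner_proj_nonneg x (f n) (hf n)) h2.summable])

end SpectralFamily

/-- The self-adjoint operator `L = ∫ t dE(t)` in `K` is a self-adjoint dilation of the dissipative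
operator `T` in `H`, where `J` embeds `H` isometrically in `K`: compressed to `H`, the resolvent
`(L - z)⁻¹ = ∫ (t - z)⁻¹ dE(t)` is `(T - z)⁻¹` for all `z` in the open lower half-plane. -/
def IsSelfAdjointDilation {H K : Type*} [NormedAddCommGroup H] [InnerProductSpace ℂ H]
    [CompleteSpace H] [NormedAddCommGroup K] [InnerProductSpace ℂ K] [CompleteSpace K]
    (T : H →L[ℂ] H) (J : H →ₗᵢ[ℂ] K) (E : SpectralFamily K) : Prop :=
  ∀ z : ℂ, z.im < 0 → ∀ x : H,
    ⟪x, Ring.inverse (T - z • (1 : H →L[ℂ] H)) x⟫_ℂ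
      = ∫ t : ℝ, ((t : ℂ) - z)⁻¹ ∂(E.measure (J x))

/-- The compression `P_H A P_H |_H` to `H` of an operator `A` in `K`. -/
noncomputable def operatorCompression {H K : Type*} [NormedAddCommGroup H] [InnerProductSpace ℂ H]
    [CompleteSpace H] [NormedAddCommGroup K] [InnerProductSpace ℂ K] [CompleteSpace K]
    (J : H →ₗᵢ[ℂ] K) (A : K →L[ℂ] K) : H →L[ℂ] H :=
  (ContinuousLinearMap.adjoint J.toContinuousLinearMap).comp (A.comp J.toContinuousLinearMap)

/-- `X` is a family of bounded self-adjoint, weakly Lebesgue measurable operators with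
`0 ≤ X(t) ≤ I` for a.e. `t` and
`log M(z) = Re (log M(i)) + ∫ X(t) ((t - z)⁻¹ - t (1 + t²)⁻¹) dt` for `z` in the upper half-plane,
the integral taken in the weak sense. (For functions from `ℝ` to `ℂ`, Lebesgue measurability
is `AEMeasurable` with respect to Lebesgue measure.) -/
structure IsExponentialHerglotzDensity {H : Type*} [NormedAddCommGroup H] [InnerProductSpace ℂ H]
    [CompleteSpace H] (M : ℂ → H →L[ℂ] H) (X : ℝ → H →L[ℂ] H) : Prop where
  isSelfAdjoint : ∀ t, IsSelfAdjoint (X t)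
  weaklyMeasurable : ∀ x y : H, AEMeasurable (fun t => ⟪x, X t y⟫_ℂ) volume
  nonneg_le_one : ∀ᵐ t ∂(volume : Measure ℝ), 0 ≤ X t ∧ X t ≤ 1
  integrable : ∀ z : ℂ, 0 < z.im → ∀ x y : H,
    Integrable (fun t : ℝ =>
      ⟪x, X t y⟫_ℂ * (((t : ℂ) - z)⁻¹ - (t : ℂ) * (1 + (t : ℂ) ^ 2)⁻¹)) volume
  representation : ∀ z : ℂ, 0 < z.im → ∀ x y : H,
    ⟪x, operatorLog (M z) y⟫_ℂ
      = ⟪x, (ℜ (operatorLog (M Complex.I)) : H →L[ℂ] H) y⟫_ℂ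
        + ∫ t : ℝ, ⟪x, X t y⟫_ℂ * (((t : ℂ) - z)⁻¹ - (t : ℂ) * (1 + (t : ℂ) ^ 2)⁻¹)

/-! Everything is reduced to the scalar functions `⟪x, log M(z) x⟫`, since over `ℂ` an operator is
determined by its quadratic form.

The basic input is that `0 ≤ Im log T ≤ π` for dissipative invertible `T`. For the lower bound,
replace `T` by `T + iδ` and rotate the path of integration from the imaginary to the positive real
axis: `log T` becomes `-∫ ((T + r)⁻¹ - (1 + r)⁻¹) dr`, and inverses of dissipative operators have
nonpositive imaginary part. The upper bound is the lower bound for the dissipative operator `-T*`,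
because `Im log T + Im log(-T*) = π` (`IsDissipative.im_inner_operatorLog_add`).

(i) Harnack's inequality for `-⟪x, (M(z) + iε)⁻¹ x⟫` carries a bound uniform in `ε` from `z₀` to the
whole disc of radius `Im z₀`, and so invertibility spreads over the half-plane.

(ii) A holomorphic function with bounded nonnegative imaginary part is the Cauchy-type integral of a
bounded density: transport it to the disc, apply Schwarz's formula on smaller circles and take a
weak limit (`exists_density_of_im_bounded`). This yields a density `ξ_x` for each vector `x`. To
obtain one operator family, let `X(t)` be the weak limit of `Ξ(M(t + i/(n+1)))` along an
ultrafilter; it exists for every `t`. By Fatou's theorem `⟪x, X(t) x⟫ = ξ_x(t)` for a.e. `t`, which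
gives both measurability and the representation.

(iii) For any density, Fatou's theorem recovers `π⟪x, X(t) x⟫` a.e. as the boundary value of `Im ⟪x,
log M x⟫`. Separability allows one null set for a countable dense set of `x`, and norm continuity of
the logarithm identifies the boundary value with `Im log M(t + i0)`. For a dilation, the resolvent
is a Cauchy transform of the spectral measure; Fubini and `∫₀^∞ t/(t² + s²) ds = (π/2) sgn t` turn
`Im log T` into `π` times the spectral mass of `(-∞, 0)`. Invertibility of `T` excludes an atom at
`0`. -/

set_option linter.unusedSectionVars false

/-! ### Resolvents of dissipative operators and continuity of the logarithm. -/

section Dissipative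

variable {H : Type*} [NormedAddCommGroup H] [InnerProductSpace ℂ H] [CompleteSpace H]

/-- An operator is dissipative when its numerical range lies in the closed upper half-plane. -/
def IsDissipative (T : H →L[ℂ] H) : Prop := ∀ x, 0 ≤ (⟪x, T x⟫_ℂ).im

theorem inner_imaginaryPart (T : H →L[ℂ] H) (x : H) :
    ⟪x, (ℑ T : H →L[ℂ] H) x⟫_ℂ = ((⟪x, T x⟫_ℂ).im : ℂ) := by
  have h : ⟪x, (star T) x⟫_ℂ = (starRingEnd ℂ) ⟪x, T x⟫_ℂ := by
    rw [ContinuousLinearMap.star_eq_adjoint, ContinuousLinearMap.adjoint_inner_right,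
      inner_conj_symm]
  rw [imaginaryPart_apply_coe, smul_apply, inner_smul_right,
    smul_apply, RCLike.real_smul_eq_coe_smul (K := ℂ), inner_smul_right,
    sub_apply, inner_sub_right, h]
  generalize (⟪x, T x⟫_ℂ) = c
  apply Complex.ext <;> simp
  ring

theorem inner_realPart (T : H →L[ℂ] H) (x : H) :
    ⟪x, (ℜ T : H →L[ℂ] H) x⟫_ℂ = ((⟪x, T x⟫_ℂ).re : ℂ) := by
  have h : ⟪x, (star T) x⟫_ℂ = (starRingEnd ℂ) ⟪x, T x⟫_ℂ := by
    rw [ContinuousLinearMap.star_eq_adjoint, ContinuousLinearMap.adjoint_inner_right,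
      inner_conj_symm]
  rw [realPart_apply_coe,
    smul_apply, RCLike.real_smul_eq_coe_smul (K := ℂ), inner_smul_right,
    add_apply, inner_add_right, h]
  generalize (⟪x, T x⟫_ℂ) = c
  apply Complex.ext <;> simp
  ring

theorem ContinuousLinearMap.nonneg_iff_inner (T : H →L[ℂ] H) :
    0 ≤ T ↔ ∀ x, 0 ≤ (⟪x, T x⟫_ℂ).re ∧ (⟪x, T x⟫_ℂ).im = 0 := by
  rw [ContinuousLinearMap.nonneg_iff_isPositive, ContinuousLinearMap.isPositive_iff_complex]
  refine forall_congr' fun x => ?_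
  have hre : (⟪T x, x⟫_ℂ).re = (⟪x, T x⟫_ℂ).re := inner_re_symm (𝕜 := ℂ) _ _
  have him : (⟪T x, x⟫_ℂ).im = -(⟪x, T x⟫_ℂ).im := inner_im_symm (𝕜 := ℂ) _ _
  rw [RCLike.re_eq_complex_re, hre, Complex.ext_iff, and_comm]
  simp [hre, him, eq_comm]

theorem imaginaryPart_nonneg_iff (T : H →L[ℂ] H) :
    0 ≤ (ℑ T : H →L[ℂ] H) ↔ IsDissipative T := by
  rw [ContinuousLinearMap.nonneg_iff_inner]
  simp [inner_imaginaryPart, IsDissipative]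

theorem ContinuousLinearMap.eq_of_inner_self {S T : H →L[ℂ] H}
    (h : ∀ x, ⟪x, S x⟫_ℂ = ⟪x, T x⟫_ℂ) : S = T := by
  have : (S : H →ₗ[ℂ] H) = T := by
    rw [← ext_inner_map]
    intro x
    have := congrArg (starRingEnd ℂ) (h x)
    simpa [inner_conj_symm] using this
  exact ContinuousLinearMap.coe_injective this

theorem IsDissipative.mono_norm {T : H →L[ℂ] H} (hT : IsDissipative T) (w : ℂ) (x : H) :
    w.im * ‖x‖ ≤ ‖(T + w • (1 : H →L[ℂ] H)) x‖ := by
  rcases eq_or_ne x 0 with rfl | hx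
  · simp
  have h1 : (⟪x, (T + w • (1 : H →L[ℂ] H)) x⟫_ℂ).im = (⟪x, T x⟫_ℂ).im + w.im * ‖x‖ ^ 2 := by
    simp [inner_self_eq_norm_sq_to_K, ← Complex.ofReal_pow]
  have h2 : (⟪x, (T + w • (1 : H →L[ℂ] H)) x⟫_ℂ).im ≤
      ‖x‖ * ‖(T + w • (1 : H →L[ℂ] H)) x‖ :=
    (Complex.abs_im_le_norm _ |> (le_abs_self _).trans).trans (norm_inner_le_norm _ _)
  have h3 := hT x
  have hx' : 0 < ‖x‖ := norm_pos_iff.2 hx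
  have : ‖x‖ * (w.im * ‖x‖) ≤ ‖x‖ * ‖(T + w • (1 : H →L[ℂ] H)) x‖ := by nlinarith
  exact le_of_mul_le_mul_left this hx'

/-- The quadratic form of `T + w` has imaginary part at least `Im w ‖x‖²`, so the operator is
coercive and the Lax–Milgram argument applies. -/
theorem IsDissipative.isUnit_add {T : H →L[ℂ] H} (hT : IsDissipative T) {w : ℂ}
    (hw : 0 < w.im) : IsUnit (T + w • (1 : H →L[ℂ] H)) := by
  refine ContinuousLinearMap.isUnit_of_forall_le_norm_inner_map _ (c := ⟨w.im, hw.le⟩)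
    (by exact_mod_cast hw) fun x => ?_
  have h1 : (⟪x, (T + w • (1 : H →L[ℂ] H)) x⟫_ℂ).im = (⟪x, T x⟫_ℂ).im + w.im * ‖x‖ ^ 2 := by
    simp [inner_self_eq_norm_sq_to_K, ← Complex.ofReal_pow]
  have h2 := (le_abs_self _).trans
    (Complex.abs_im_le_norm ⟪x, (T + w • (1 : H →L[ℂ] H)) x⟫_ℂ)
  rw [norm_inner_symm]
  have h3 := hT x
  calc ‖x‖ ^ 2 * w.im ≤ (⟪x, T x⟫_ℂ).im + w.im * ‖x‖ ^ 2 := by linarith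
    _ ≤ _ := h1 ▸ h2

theorem IsDissipative.add {T : H →L[ℂ] H} (hT : IsDissipative T) {w : ℂ} (hw : 0 ≤ w.im) :
    IsDissipative (T + w • (1 : H →L[ℂ] H)) := by
  intro x
  have h1 : (⟪x, (T + w • (1 : H →L[ℂ] H)) x⟫_ℂ).im = (⟪x, T x⟫_ℂ).im + w.im * ‖x‖ ^ 2 := by
    simp [inner_self_eq_norm_sq_to_K, ← Complex.ofReal_pow]
  rw [h1]
  have := hT x
  positivity

theorem apply_inverse {S : H →L[ℂ] H} (hS : IsUnit S) (x : H) : S (Ring.inverse S x) = x := by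
  have := congrArg (fun A : H →L[ℂ] H => A x) (Ring.mul_inverse_cancel S hS)
  simpa using this

theorem inverse_apply {S : H →L[ℂ] H} (hS : IsUnit S) (x : H) : Ring.inverse S (S x) = x := by
  have := congrArg (fun A : H →L[ℂ] H => A x) (Ring.inverse_mul_cancel S hS)
  simpa using this

theorem norm_inverse_le_of_forall {S : H →L[ℂ] H} (hS : IsUnit S) {C : ℝ} (hC : 0 ≤ C)
    (h : ∀ x, ‖x‖ ≤ C * ‖S x‖) : ‖Ring.inverse S‖ ≤ C := by
  refine ContinuousLinearMap.opNorm_le_bound _ hC fun x => ?_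
  simpa [apply_inverse hS] using h (Ring.inverse S x)

theorem IsDissipative.isUnit_add_I_mul {T : H →L[ℂ] H} (hT : IsDissipative T) (hu : IsUnit T)
    {s : ℝ} (hs : 0 ≤ s) : IsUnit (T + (Complex.I * (s : ℂ)) • (1 : H →L[ℂ] H)) := by
  rcases hs.eq_or_lt with rfl | hs
  · simpa using hu
  · exact hT.isUnit_add (by simpa using hs)

/-- For `y = (T + is)x`, dissipativity gives `s‖x‖ ≤ ‖y‖`, which degenerates at `s = 0`. There
invertibility of `T` takes over: `Tx = y - isx` gives `‖x‖ ≤ 2‖T⁻¹‖‖y‖`. Adding the two covers all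
`s ≥ 0`. -/
theorem IsDissipative.norm_inverse_add_I_mul_le {T : H →L[ℂ] H} (hT : IsDissipative T)
    (hu : IsUnit T) {s : ℝ} (hs : 0 ≤ s) :
    ‖Ring.inverse (T + (Complex.I * (s : ℂ)) • (1 : H →L[ℂ] H))‖ ≤
      (1 + 2 * ‖Ring.inverse T‖) / (1 + s) := by
  refine norm_inverse_le_of_forall (hT.isUnit_add_I_mul hu hs) (by positivity) fun x => ?_
  have h1 := hT.mono_norm (Complex.I * (s : ℂ)) x
  set y := (T + (Complex.I * (s : ℂ)) • (1 : H →L[ℂ] H)) x with hy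
  have h2 : ‖x‖ ≤ ‖Ring.inverse T‖ * (‖y‖ + s * ‖x‖) := by
    have h3 : T x = y - (Complex.I * (s : ℂ)) • x := by simp [hy]
    calc ‖x‖ = ‖Ring.inverse T (T x)‖ := by rw [inverse_apply hu]
      _ ≤ ‖Ring.inverse T‖ * ‖T x‖ := ContinuousLinearMap.le_opNorm _ _
      _ ≤ _ := by
        gcongr
        rw [h3]
        refine (norm_sub_le _ _).trans ?_
        simp [norm_smul, abs_of_nonneg hs]
  rw [div_mul_eq_mul_div, le_div_iff₀ (by positivity)]
  have h4 : s * ‖x‖ ≤ ‖y‖ := by simpa using h1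
  have h5 : ‖Ring.inverse T‖ * (‖y‖ + s * ‖x‖) ≤ ‖Ring.inverse T‖ * (2 * ‖y‖) := by
    gcongr; linarith
  linarith

/-- A resolvent identity: the difference of two terms of order `1/|w|` becomes a product of them,
hence of order `1/|w|²`. This is what makes the logarithm integral converge. -/
theorem inverse_sub_smul_one {S : H →L[ℂ] H} (hS : IsUnit S) {c w : ℂ} (hc : c + w ≠ 0)
    (T : H →L[ℂ] H) (hST : S = T + w • 1) :
    Ring.inverse S - (c + w)⁻¹ • (1 : H →L[ℂ] H) =
      (c + w)⁻¹ • (Ring.inverse S * (c • 1 - T)) := by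
  have h : c • (1 : H →L[ℂ] H) - T = (c + w) • 1 - S := by rw [hST, add_smul]; abel
  rw [h, mul_sub, Ring.inverse_mul_cancel S hS, smul_sub, mul_smul_comm, smul_smul,
    inv_mul_cancel₀ hc, one_smul, mul_one]

/-- The integrand in the definition of `operatorLog`. -/
noncomputable def logIntegrand (T : H →L[ℂ] H) (s : ℝ) : H →L[ℂ] H :=
  Ring.inverse (T + (Complex.I * (s : ℂ)) • (1 : H →L[ℂ] H))
      - ((1 + Complex.I * (s : ℂ))⁻¹) • (1 : H →L[ℂ] H)

theorem one_add_I_mul_ne_zero (s : ℝ) : (1 : ℂ) + Complex.I * s ≠ 0 := by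
  intro h
  simpa using congrArg Complex.re h

theorem norm_inv_one_add_I_mul_le {s : ℝ} (hs : 0 ≤ s) :
    ‖((1 : ℂ) + Complex.I * s)⁻¹‖ / (1 + s) ≤ (1 + s ^ 2)⁻¹ := by
  have h : ‖(1 : ℂ) + Complex.I * s‖ = √(1 + s ^ 2) := by
    rw [mul_comm]
    simpa using Complex.norm_add_mul_I 1 s
  rw [norm_inv, h, ← one_div, div_div, ← one_div]
  apply one_div_le_one_div_of_le (by positivity)
  have h2 : √(1 + s ^ 2) ≤ 1 + s := by
    rw [Real.sqrt_le_left (by positivity)]; nlinarith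
  calc 1 + s ^ 2 = √(1 + s ^ 2) * √(1 + s ^ 2) := (Real.mul_self_sqrt (by positivity)).symm
    _ ≤ _ := by gcongr

theorem IsDissipative.norm_logIntegrand_le {T : H →L[ℂ] H} (hT : IsDissipative T)
    (hu : IsUnit T) {s : ℝ} (hs : 0 ≤ s) :
    ‖logIntegrand T s‖ ≤ (1 + 2 * ‖Ring.inverse T‖) * ‖1 - T‖ * (1 + s ^ 2)⁻¹ := by
  have h := inverse_sub_smul_one (hT.isUnit_add_I_mul hu hs) (one_add_I_mul_ne_zero s) T rfl
  rw [one_smul] at h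
  rw [logIntegrand, h, norm_smul]
  calc _ ≤ ‖((1 : ℂ) + Complex.I * s)⁻¹‖ *
        ((1 + 2 * ‖Ring.inverse T‖) / (1 + s) * ‖1 - T‖) := by
        gcongr
        exact (norm_mul_le _ _).trans (by gcongr; exact hT.norm_inverse_add_I_mul_le hu hs)
    _ = (1 + 2 * ‖Ring.inverse T‖) * ‖1 - T‖ * (‖((1 : ℂ) + Complex.I * s)⁻¹‖ / (1 + s)) := by
        ring
    _ ≤ _ := by gcongr; exact norm_inv_one_add_I_mul_le hs

theorem continuousAt_inverse_of_isUnit {S : H →L[ℂ] H} (hS : IsUnit S) :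
    ContinuousAt Ring.inverse S := by
  obtain ⟨u, rfl⟩ := hS
  exact NormedRing.inverse_continuousAt u

theorem IsDissipative.continuousOn_inverse_add_I_mul {T : H →L[ℂ] H} (hT : IsDissipative T)
    (hu : IsUnit T) : ContinuousOn
      (fun s : ℝ => Ring.inverse (T + (Complex.I * (s : ℂ)) • (1 : H →L[ℂ] H))) (Set.Ici 0) := by
  intro s hs
  refine ContinuousAt.continuousWithinAt ?_
  refine ContinuousAt.comp (g := Ring.inverse)
    (continuousAt_inverse_of_isUnit (hT.isUnit_add_I_mul hu hs)) ?_
  fun_prop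

theorem IsDissipative.continuousOn_logIntegrand {T : H →L[ℂ] H} (hT : IsDissipative T)
    (hu : IsUnit T) : ContinuousOn (logIntegrand T) (Set.Ici 0) := by
  refine (hT.continuousOn_inverse_add_I_mul hu).sub (Continuous.continuousOn ?_)
  refine Continuous.smul (Continuous.inv₀ (by fun_prop) one_add_I_mul_ne_zero) continuous_const

theorem IsDissipative.aestronglyMeasurable_logIntegrand {T : H →L[ℂ] H} (hT : IsDissipative T)
    (hu : IsUnit T) :
    AEStronglyMeasurable (logIntegrand T) (volume.restrict (Set.Ioi (0 : ℝ))) :=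
  ((hT.continuousOn_logIntegrand hu).mono Set.Ioi_subset_Ici_self).aestronglyMeasurable
    measurableSet_Ioi

theorem IsDissipative.integrableOn_logIntegrand {T : H →L[ℂ] H} (hT : IsDissipative T)
    (hu : IsUnit T) : IntegrableOn (logIntegrand T) (Set.Ioi 0) := by
  refine Integrable.mono' ((integrable_inv_one_add_sq.const_mul
    ((1 + 2 * ‖Ring.inverse T‖) * ‖1 - T‖)).integrableOn)
    (hT.aestronglyMeasurable_logIntegrand hu) ?_
  exact (ae_restrict_iff' measurableSet_Ioi).2 (Eventually.of_forall fun s hs =>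
    hT.norm_logIntegrand_le hu (le_of_lt hs))

theorem operatorLog_eq (T : H →L[ℂ] H) :
    operatorLog T = (-Complex.I) • ∫ s in Set.Ioi (0 : ℝ), logIntegrand T s := rfl

/-- Dominated convergence: `‖(A i)⁻¹‖` and `‖1 - A i‖` converge, hence are eventually at most their
limits plus one, and the pointwise bound on the integrand becomes uniform. -/
theorem tendsto_operatorLog {ι : Type*} {l : Filter ι} [l.IsCountablyGenerated]
    {A : ι → H →L[ℂ] H} {T : H →L[ℂ] H} (hT : IsDissipative T) (hu : IsUnit T)
    (hA : ∀ᶠ i in l, IsDissipative (A i)) (h : Tendsto A l (𝓝 T)) :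
    Tendsto (fun i => operatorLog (A i)) l (𝓝 (operatorLog T)) := by
  have hunit : ∀ᶠ i in l, IsUnit (A i) := h.eventually (by
    obtain ⟨u, rfl⟩ := hu
    exact Units.nhds u)
  have hinv : Tendsto (fun i => ‖Ring.inverse (A i)‖) l (𝓝 ‖Ring.inverse T‖) :=
    ((continuousAt_inverse_of_isUnit hu).tendsto.comp h).norm
  have hb1 := hinv.eventually (gt_mem_nhds (lt_add_one _))
  have hb2 := (h.const_sub 1).norm.eventually (gt_mem_nhds (lt_add_one _))
  simp only [operatorLog_eq]
  refine Tendsto.const_smul ?_ _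
  refine tendsto_integral_filter_of_dominated_convergence
    (fun s => (1 + 2 * (‖Ring.inverse T‖ + 1)) * (‖1 - T‖ + 1) * (1 + s ^ 2)⁻¹) ?_ ?_
    (integrable_inv_one_add_sq.const_mul _).integrableOn ?_
  · filter_upwards [hA, hunit] with i h1 h2 using h1.aestronglyMeasurable_logIntegrand h2
  · filter_upwards [hA, hunit, hb1, hb2] with i h1 h2 h3 h4
    refine (ae_restrict_iff' measurableSet_Ioi).2 (Eventually.of_forall fun s hs => ?_)
    exact (h1.norm_logIntegrand_le h2 (le_of_lt hs)).trans (by gcongr)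
  · refine (ae_restrict_iff' measurableSet_Ioi).2 (Eventually.of_forall fun s hs => ?_)
    refine Tendsto.sub_const ?_ _
    exact (continuousAt_inverse_of_isUnit (hT.isUnit_add_I_mul hu (le_of_lt hs))).tendsto.comp
      (h.add_const _)

theorem IsDissipative.integrableOn_inner_logIntegrand {T : H →L[ℂ] H} (hT : IsDissipative T)
    (hu : IsUnit T) (x : H) : IntegrableOn (fun s => ⟪x, logIntegrand T s x⟫_ℂ) (Set.Ioi 0) :=
  (((innerSL ℂ x).comp (ContinuousLinearMap.apply ℂ H x)).integrable_comp
    (hT.integrableOn_logIntegrand hu) :)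

theorem IsDissipative.inner_operatorLog {T : H →L[ℂ] H} (hT : IsDissipative T)
    (hu : IsUnit T) (x : H) : ⟪x, operatorLog T x⟫_ℂ =
      -Complex.I * ∫ s in Set.Ioi (0 : ℝ), ⟪x, logIntegrand T s x⟫_ℂ := by
  rw [operatorLog_eq, smul_apply, inner_smul_right]
  congr 1
  exact (((innerSL ℂ x).comp (ContinuousLinearMap.apply ℂ H x)).integral_comp_comm
    (hT.integrableOn_logIntegrand hu)).symm

theorem re_inner_logIntegrand (T : H →L[ℂ] H) (x : H) (s : ℝ) :
    (⟪x, logIntegrand T s x⟫_ℂ).re =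
      (⟪x, Ring.inverse (T + (Complex.I * (s : ℂ)) • (1 : H →L[ℂ] H)) x⟫_ℂ).re
        - ‖x‖ ^ 2 * (1 + s ^ 2)⁻¹ := by
  have h : ((1 + Complex.I * (s : ℂ))⁻¹).re = (1 + s ^ 2)⁻¹ := by
    rw [Complex.inv_re]
    simp [Complex.normSq_apply, sq]
  simp only [logIntegrand, sub_apply, inner_sub_right,
    smul_apply, inner_smul_right, one_apply_eq_self,
    inner_self_eq_norm_sq_to_K, Complex.sub_re, Complex.mul_re, h]
  simp [← Complex.ofReal_pow]
  ring

theorem IsDissipative.im_inner_operatorLog {T : H →L[ℂ] H} (hT : IsDissipative T)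
    (hu : IsUnit T) (x : H) : (⟪x, operatorLog T x⟫_ℂ).im =
      -∫ s in Set.Ioi (0 : ℝ), ((⟪x, Ring.inverse (T +
        (Complex.I * (s : ℂ)) • (1 : H →L[ℂ] H)) x⟫_ℂ).re - ‖x‖ ^ 2 * (1 + s ^ 2)⁻¹) := by
  rw [hT.inner_operatorLog hu]
  simp only [← re_inner_logIntegrand]
  have := integral_re (hT.integrableOn_inner_logIntegrand hu x)
  simp only [RCLike.re_eq_complex_re] at this
  rw [this]
  simp

end Dissipative

/-! ### The bounds `0 ≤ Im log T ≤ π`. -/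

theorem norm_inverse_one_add_le_two {w : ℂ} (hw : 0 ≤ w.re) :
    ‖((1 : ℂ) + w)⁻¹‖ ≤ 2 / (1 + ‖w‖) := by
  have h : 1 + ‖w‖ ≤ 2 * ‖(1 : ℂ) + w‖ := by
    have h1 : 1 ≤ ‖(1 : ℂ) + w‖ := by
      refine le_trans ?_ (Complex.re_le_norm _)
      simpa using hw
    have h2 : ‖w‖ ≤ ‖(1 : ℂ) + w‖ := by
      rw [Complex.norm_eq_sqrt_sq_add_sq, Complex.norm_eq_sqrt_sq_add_sq]
      apply Real.sqrt_le_sqrt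
      simp
      nlinarith
    linarith
  rw [norm_inv, le_div_iff₀ (by positivity), inv_mul_le_iff₀]
  · linarith
  · have := norm_nonneg w
    linarith

/-- Rotating the ray of integration of a holomorphic function across the first quadrant. -/
theorem integral_Ioi_eq_I_smul_integral_Ioi {E : Type*} [NormedAddCommGroup E] [NormedSpace ℂ E]
    [CompleteSpace E] {F : ℂ → E} {C : ℝ}
    (hF : DifferentiableOn ℂ F {w : ℂ | 0 ≤ w.re ∧ 0 ≤ w.im})
    (hb : ∀ w : ℂ, 0 ≤ w.re → 0 ≤ w.im → ‖F w‖ ≤ C / (1 + ‖w‖) ^ 2) :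
    ∫ r in Set.Ioi (0 : ℝ), F r = Complex.I • ∫ r in Set.Ioi (0 : ℝ), F (Complex.I * r) := by
  have hC : 0 ≤ C := by simpa using (norm_nonneg _).trans (hb 0 le_rfl le_rfl)
  have hbd : ∀ r : ℝ, 0 ≤ r → C / (1 + r) ^ 2 ≤ C * (1 + r ^ 2)⁻¹ := by
    intro r hr
    rw [div_eq_mul_inv]
    gcongr
    nlinarith
  have hint : ∀ g : ℝ → ℂ, Continuous g → (∀ r, 0 ≤ r → 0 ≤ (g r).re ∧ 0 ≤ (g r).im ∧ ‖g r‖ = r) →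
      IntegrableOn (fun r => F (g r)) (Set.Ioi 0) := by
    intro g hg hgq
    refine Integrable.mono' ((integrable_inv_one_add_sq.const_mul C).integrableOn) ?_ ?_
    · refine ContinuousOn.aestronglyMeasurable ?_ measurableSet_Ioi
      exact hF.continuousOn.comp hg.continuousOn fun r hr =>
        ⟨(hgq r (le_of_lt hr)).1, (hgq r (le_of_lt hr)).2.1⟩
    · refine (ae_restrict_iff' measurableSet_Ioi).2 (Eventually.of_forall fun r hr => ?_)
      obtain ⟨h1, h2, h3⟩ := hgq r (le_of_lt hr)
      have := hb _ h1 h2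
      rw [h3] at this
      exact this.trans (hbd r (le_of_lt hr))
  have hlim1 := intervalIntegral_tendsto_integral_Ioi 0
    (hint (fun r => (r : ℂ)) (by fun_prop) (fun r hr => by simp [hr, abs_of_nonneg])) tendsto_id
  have hlim2 := intervalIntegral_tendsto_integral_Ioi 0
    (hint (fun r => Complex.I * (r : ℂ)) (by fun_prop)
      (fun r hr => by simp [hr, abs_of_nonneg])) tendsto_id
  -- Each far side of the square with corner `R + iR` has length `R`, and the integrand there is at
  -- most `C / R²`.
  have hfar : ∀ g : ℝ → ℝ → ℂ, (∀ R r, 0 ≤ r → 0 ≤ R → 0 ≤ (g R r).re ∧ 0 ≤ (g R r).im ∧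
      R ≤ ‖g R r‖) → Tendsto (fun R => ∫ r in (0 : ℝ)..R, F (g R r)) atTop (𝓝 0) := by
    intro g hg
    have h0 : Tendsto (fun R : ℝ => C / R) atTop (𝓝 0) := tendsto_const_nhds.div_atTop tendsto_id
    refine squeeze_zero_norm' ?_ h0
    filter_upwards [eventually_gt_atTop 0] with R hR
    have : ∀ r ∈ Set.uIoc 0 R, ‖F (g R r)‖ ≤ C / R ^ 2 := by
      intro r hr
      rw [Set.uIoc_of_le hR.le] at hr
      obtain ⟨h1, h2, h3⟩ := hg R r hr.1.le hR.le
      refine (hb _ h1 h2).trans ?_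
      gcongr
      linarith
    refine (intervalIntegral.norm_integral_le_of_norm_le_const this).trans (le_of_eq ?_)
    rw [sub_zero, abs_of_pos hR]
    field_simp
  have hfar1 := hfar (fun R r => r + R * Complex.I) (fun R r hr hR => by
    refine ⟨by simpa using hr, by simpa using hR, ?_⟩
    refine le_trans ?_ (Complex.abs_im_le_norm _)
    simp [abs_of_nonneg hR])
  have hfar2 := hfar (fun R r => R + r * Complex.I) (fun R r hr hR => by
    refine ⟨by simpa using hR, by simpa using hr, ?_⟩
    refine le_trans ?_ (Complex.abs_re_le_norm _)
    simp [abs_of_nonneg hR])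
  have hrect : ∀ᶠ R : ℝ in atTop, (∫ r in (0 : ℝ)..R, F r)
      - (∫ r in (0 : ℝ)..R, F (r + R * Complex.I))
      + Complex.I • (∫ r in (0 : ℝ)..R, F (R + r * Complex.I))
      - Complex.I • (∫ r in (0 : ℝ)..R, F (Complex.I * r)) = 0 := by
    filter_upwards [eventually_ge_atTop 0] with R hR
    have := Complex.integral_boundary_rect_eq_zero_of_differentiableOn F 0 (R + R * Complex.I)
      (hF.mono ?_)
    · simpa [mul_comm] using this
    · intro w hw
      rw [Complex.mem_reProdIm] at hw
      simp [Set.uIcc_of_le hR] at hw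
      exact ⟨hw.1.1, hw.2.1⟩
  have hlim := ((hlim1.sub hfar1).add (hfar2.const_smul Complex.I)).sub
    (hlim2.const_smul Complex.I)
  have h0 := tendsto_nhds_unique (hlim.congr' hrect) tendsto_const_nhds
  simpa [sub_eq_zero] using h0

section Dissipative

variable {H : Type*} [NormedAddCommGroup H] [InnerProductSpace ℂ H] [CompleteSpace H]

/-- The shift by `iδ` gives coercivity `δ` uniformly in `w`, and solving for `w • x` supplies the
decay in `|w|`. The estimate thus covers the whole quadrant swept by the rotated ray. -/
theorem IsDissipative.norm_inverse_add_le {T : H →L[ℂ] H} (hT : IsDissipative T) {δ : ℝ}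
    (hδ : 0 < δ) {w : ℂ} (hw : 0 ≤ w.im) :
    ‖Ring.inverse (T + (w + δ * Complex.I) • (1 : H →L[ℂ] H))‖ ≤
      (1 + (1 + ‖T‖ + δ) / δ) / (1 + ‖w‖) := by
  have him : (w + δ * Complex.I).im = w.im + δ := by simp
  refine norm_inverse_le_of_forall (hT.isUnit_add (by rw [him]; positivity))
    (by positivity) fun x => ?_
  have h1 := hT.mono_norm (w + δ * Complex.I) x
  rw [him] at h1
  set y := (T + (w + δ * Complex.I) • (1 : H →L[ℂ] H)) x with hy
  have h2 : ‖x‖ ≤ ‖y‖ / δ := by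
    rw [le_div_iff₀ hδ]
    nlinarith [norm_nonneg x]
  have h3 : ‖w‖ * ‖x‖ ≤ ‖y‖ + (‖T‖ + δ) * ‖x‖ := by
    have : w • x = y - T x - (δ * Complex.I : ℂ) • x := by
      simp [hy, add_smul]
    rw [← norm_smul, this]
    refine (norm_sub_le _ _).trans ?_
    have h4 := norm_sub_le y (T x)
    have h5 := T.le_opNorm x
    have h6 : ‖(δ * Complex.I : ℂ) • x‖ = δ * ‖x‖ := by simp [norm_smul, abs_of_pos hδ]
    linarith
  rw [div_mul_eq_mul_div, le_div_iff₀ (by positivity)]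
  have h7 : (1 + ‖T‖ + δ) * ‖x‖ ≤ (1 + ‖T‖ + δ) * (‖y‖ / δ) := by gcongr
  calc ‖x‖ * (1 + ‖w‖) ≤ ‖y‖ + (1 + ‖T‖ + δ) * ‖x‖ := by linarith
    _ ≤ ‖y‖ + (1 + ‖T‖ + δ) * (‖y‖ / δ) := by linarith
    _ = _ := by ring

/-- After rotation to the positive axis the subtracted scalar is real, so only `(S + r)⁻¹`
contributes to the imaginary part. With `u = (S + r)⁻¹ x`, dissipativity reads `Im ⟪u, x⟫ ≥ 0`. -/
theorem IsDissipative.operatorLog_add {T : H →L[ℂ] H} (hT : IsDissipative T) {δ : ℝ}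
    (hδ : 0 < δ) : IsDissipative (operatorLog (T + (δ * Complex.I : ℂ) • (1 : H →L[ℂ] H))) := by
  intro x
  set S := T + (δ * Complex.I : ℂ) • (1 : H →L[ℂ] H) with hS
  have hSw : ∀ w : ℂ, S + w • 1 = T + (w + δ * Complex.I) • 1 := by
    intro w; rw [hS, add_smul]; abel
  have him : ∀ w : ℂ, (w + δ * Complex.I).im = w.im + δ := by simp
  have hSd : IsDissipative S := hT.add (by simpa using hδ.le)
  have hSu : IsUnit S := hT.isUnit_add (by simpa using hδ)
  have hSwu : ∀ w : ℂ, 0 ≤ w.im → IsUnit (S + w • (1 : H →L[ℂ] H)) := by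
    intro w hw
    rw [hSw]
    exact hT.isUnit_add (by rw [him]; positivity)
  let F : ℂ → H →L[ℂ] H := fun w =>
    Ring.inverse (S + w • (1 : H →L[ℂ] H)) - (1 + w)⁻¹ • (1 : H →L[ℂ] H)
  have hne : ∀ w : ℂ, 0 ≤ w.re → 1 + w ≠ 0 := by
    intro w hw h
    have := congrArg Complex.re h
    simp at this
    linarith
  have hFd : DifferentiableOn ℂ F {w : ℂ | 0 ≤ w.re ∧ 0 ≤ w.im} := by
    intro w hw
    refine DifferentiableAt.differentiableWithinAt ?_
    refine DifferentiableAt.sub ?_ ?_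
    · exact DifferentiableAt.comp (g := Ring.inverse) w
        (differentiableAt_inverse (hSwu w hw.2)) (by fun_prop)
    · exact (DifferentiableAt.inv (by fun_prop) (hne w hw.1)).smul_const _
  have hFb : ∀ w : ℂ, 0 ≤ w.re → 0 ≤ w.im →
      ‖F w‖ ≤ (2 * ((1 + (1 + ‖T‖ + δ) / δ) * ‖1 - S‖)) / (1 + ‖w‖) ^ 2 := by
    intro w h1 h2
    have h := inverse_sub_smul_one (hSwu w h2) (hne w h1) S rfl
    rw [one_smul] at h
    simp only [F]
    rw [h, norm_smul]
    have h3 := hT.norm_inverse_add_le hδ h2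
    rw [← hSw] at h3
    calc _ ≤ 2 / (1 + ‖w‖) * ((1 + (1 + ‖T‖ + δ) / δ) / (1 + ‖w‖) * ‖1 - S‖) := by
          gcongr
          · exact norm_inverse_one_add_le_two h1
          · exact (norm_mul_le _ _).trans (by gcongr)
      _ = _ := by
        generalize (1 + ‖T‖ + δ) / δ = q
        field_simp
  have hrot := integral_Ioi_eq_I_smul_integral_Ioi hFd hFb
  have hlog : operatorLog S = -∫ r in Set.Ioi (0 : ℝ), F r := by
    rw [hrot, operatorLog_eq, neg_smul]
    rfl
  have hint : IntegrableOn (fun r : ℝ => F r) (Set.Ioi 0) := by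
    refine Integrable.mono' ((integrable_inv_one_add_sq.const_mul
      (2 * ((1 + (1 + ‖T‖ + δ) / δ) * ‖1 - S‖))).integrableOn) ?_ ?_
    · refine ContinuousOn.aestronglyMeasurable ?_ measurableSet_Ioi
      exact hFd.continuousOn.comp (by fun_prop) fun r hr => ⟨by simpa using le_of_lt hr, by simp⟩
    · refine (ae_restrict_iff' measurableSet_Ioi).2 (Eventually.of_forall fun r hr => ?_)
      have hr' : 0 ≤ r := le_of_lt hr
      refine (hFb r (by simpa using hr') (by simp)).trans ?_
      rw [Complex.norm_real, Real.norm_of_nonneg hr', div_eq_mul_inv]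
      gcongr
      nlinarith
  let L : (H →L[ℂ] H) →L[ℂ] ℂ := (innerSL ℂ x).comp (ContinuousLinearMap.apply ℂ H x)
  have hL : ∀ A : H →L[ℂ] H, L A = ⟪x, A x⟫_ℂ := fun _ => rfl
  rw [← hL, hlog, map_neg, ← L.integral_comp_comm hint]
  have him2 := integral_im (L.integrable_comp hint)
  simp only [RCLike.im_eq_complex_im] at him2
  rw [Complex.neg_im, ← him2, ← integral_neg]
  refine setIntegral_nonneg measurableSet_Ioi fun r hr => ?_
  have hr' : 0 ≤ r := le_of_lt hr
  have hu := hSwu r (by simp)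
  have h1 : ((1 + (r : ℂ))⁻¹).im = 0 := by
    rw [← Complex.ofReal_one, ← Complex.ofReal_add, ← Complex.ofReal_inv, Complex.ofReal_im]
  rw [hL]
  simp only [F, sub_apply, smul_apply, inner_sub_right, inner_smul_right, one_apply_eq_self,
    inner_self_eq_norm_sq_to_K, Complex.sub_im]
  have h2 : (((1 + (r : ℂ))⁻¹) * ((‖x‖ : ℝ) : ℂ) ^ 2).im = 0 := by
    rw [← Complex.ofReal_pow, Complex.im_mul_ofReal, h1, zero_mul]
  have h3 : 0 ≤ (⟪Ring.inverse (S + (r : ℂ) • (1 : H →L[ℂ] H)) x, x⟫_ℂ).im := by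
    have := (hSd.add (w := r) (by simp)) (Ring.inverse (S + (r : ℂ) • (1 : H →L[ℂ] H)) x)
    rwa [apply_inverse hu] at this
  have h4 : (⟪Ring.inverse (S + (r : ℂ) • (1 : H →L[ℂ] H)) x, x⟫_ℂ).im =
    -(⟪x, Ring.inverse (S + (r : ℂ) • (1 : H →L[ℂ] H)) x⟫_ℂ).im := inner_im_symm (𝕜 := ℂ) _ _
  erw [h2]
  linarith

theorem tendsto_add_mul_I (T : H →L[ℂ] H) :
    Tendsto (fun δ : ℝ => T + (δ * Complex.I : ℂ) • (1 : H →L[ℂ] H)) (𝓝[>] 0) (𝓝 T) := by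
  have : Continuous (fun δ : ℝ => T + (δ * Complex.I : ℂ) • (1 : H →L[ℂ] H)) := by fun_prop
  have h := (this.tendsto 0).mono_left (nhdsWithin_le_nhds (s := Set.Ioi 0))
  simpa using h

theorem IsDissipative.operatorLog {T : H →L[ℂ] H} (hT : IsDissipative T) (hu : IsUnit T) :
    IsDissipative (operatorLog T) := by
  intro x
  have h : Tendsto (fun δ : ℝ => _root_.operatorLog (T + (δ * Complex.I : ℂ) • (1 : H →L[ℂ] H)))
      (𝓝[>] 0) (𝓝 (_root_.operatorLog T)) := by
    refine tendsto_operatorLog hT hu ?_ (tendsto_add_mul_I T)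
    filter_upwards [self_mem_nhdsWithin] with δ hδ
    exact hT.add (by simpa using le_of_lt hδ)
  have hc : Continuous fun A : H →L[ℂ] H => (⟪x, A x⟫_ℂ).im := by fun_prop
  refine ge_of_tendsto ((hc.tendsto _).comp h) ?_
  filter_upwards [self_mem_nhdsWithin] with δ hδ
  exact hT.operatorLog_add hδ x

theorem IsDissipative.neg_star {T : H →L[ℂ] H} (hT : IsDissipative T) :
    IsDissipative (-star T) := by
  intro x
  have h := hT x
  have h2 : (⟪T x, x⟫_ℂ).im = -(⟪x, T x⟫_ℂ).im := inner_im_symm (𝕜 := ℂ) _ _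
  rw [ContinuousLinearMap.star_eq_adjoint, neg_apply, inner_neg_right,
    ContinuousLinearMap.adjoint_inner_right, Complex.neg_im, h2]
  simpa using h

/-- Since `-T* + is = -(T + is)*`, the real parts of the two resolvent forms cancel. What remains is
`2‖x‖² ∫₀^∞ (1 + s²)⁻¹ ds`. -/
theorem IsDissipative.im_inner_operatorLog_add {T : H →L[ℂ] H} (hT : IsDissipative T)
    (hu : IsUnit T) (x : H) :
    (⟪x, _root_.operatorLog T x⟫_ℂ).im + (⟪x, _root_.operatorLog (-star T) x⟫_ℂ).im =
      Real.pi * ‖x‖ ^ 2 := by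
  have hu' : IsUnit (-star T) := hu.star.neg
  rw [hT.im_inner_operatorLog hu, hT.neg_star.im_inner_operatorLog hu', ← neg_add,
    ← integral_add, ← integral_neg]
  · have : ∀ s : ℝ, 0 ≤ s → (⟪x, Ring.inverse (-star T + (Complex.I * (s : ℂ)) • (1 : H →L[ℂ] H)) x⟫_ℂ).re
        = -(⟪x, Ring.inverse (T + (Complex.I * (s : ℂ)) • (1 : H →L[ℂ] H)) x⟫_ℂ).re := by
      intro s hs
      have h1 : -star T + (Complex.I * (s : ℂ)) • (1 : H →L[ℂ] H) =
          -star (T + (Complex.I * (s : ℂ)) • (1 : H →L[ℂ] H)) := by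
        simp [star_add, star_smul, add_comm]
      have h2 : Ring.inverse (-star (T + (Complex.I * (s : ℂ)) • (1 : H →L[ℂ] H))) =
          -star (Ring.inverse (T + (Complex.I * (s : ℂ)) • (1 : H →L[ℂ] H))) := by
        rw [← Ring.inverse_star]
        have hv := (hT.isUnit_add_I_mul hu hs).star
        rw [← hv.unit_spec, ← Units.val_neg, Ring.inverse_unit, Ring.inverse_unit]
        simp
      rw [h1, h2, ContinuousLinearMap.star_eq_adjoint, neg_apply, inner_neg_right,
        ContinuousLinearMap.adjoint_inner_right, Complex.neg_re]
      congr 1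
      exact inner_re_symm (𝕜 := ℂ) _ _
    rw [setIntegral_congr_fun measurableSet_Ioi (g := fun s => 2 * (‖x‖ ^ 2 * (1 + s ^ 2)⁻¹))]
    swap
    · intro s hs
      simp only [this s (le_of_lt hs)]
      ring
    rw [integral_const_mul, integral_const_mul, integral_Ioi_inv_one_add_sq]
    simp
    ring
  · simpa only [← re_inner_logIntegrand, RCLike.re_eq_complex_re] using (hT.integrableOn_inner_logIntegrand hu x).re
  · simpa only [← re_inner_logIntegrand, RCLike.re_eq_complex_re] using
      (hT.neg_star.integrableOn_inner_logIntegrand hu' x).re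

theorem IsDissipative.im_inner_operatorLog_le {T : H →L[ℂ] H} (hT : IsDissipative T)
    (hu : IsUnit T) (x : H) : (⟪x, _root_.operatorLog T x⟫_ℂ).im ≤ Real.pi * ‖x‖ ^ 2 := by
  have h := hT.neg_star.operatorLog hu.star.neg x
  have h2 := hT.im_inner_operatorLog_add hu x
  linarith

end Dissipative

/-! ### Operator Herglotz functions: propagation of invertibility and analyticity of `log M`. -/

theorem isOpen_im_pos : IsOpen {z : ℂ | 0 < z.im} := isOpen_lt continuous_const Complex.continuous_im

theorem im_pos_of_mem_ball {z w : ℂ} (h : w ∈ Metric.ball z z.im) : 0 < w.im := by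
  have h1 := Complex.abs_im_le_norm (w - z)
  rw [Metric.mem_ball, dist_eq_norm] at h
  have h2 := (abs_lt.1 (h1.trans_lt h)).1
  simp at h2
  linarith

/-- Harnack's inequality for functions with nonnegative imaginary part on a disc. -/
theorem norm_le_of_im_nonneg_on_ball {f : ℂ → ℂ} {z₀ z : ℂ} {R : ℝ} (hR : 0 < R)
    (hf : DifferentiableOn ℂ f (Metric.ball z₀ R)) (him : ∀ w ∈ Metric.ball z₀ R, 0 ≤ (f w).im)
    (hz : z ∈ Metric.ball z₀ R) :
    ‖f z‖ ≤ ‖f z₀‖ * (R + ‖z - z₀‖) / (R - ‖z - z₀‖) := by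
  have hmap : Set.MapsTo (fun w => z₀ + w) (Metric.ball 0 R) (Metric.ball z₀ R) := by
    intro w hw
    simpa using hw
  have hd : DifferentiableOn ℂ (fun w => Complex.I * f (z₀ + w)) (Metric.ball 0 R) :=
    (hf.comp (by fun_prop) hmap).const_mul _
  have hz' : z - z₀ ∈ Metric.ball (0 : ℂ) R := by simpa [dist_eq_norm] using hz
  -- Borel–Carathéodory is applied to `i f`, whose real part is `≤ 0`; it asks for a positive bound
  -- `m`, which is then sent to `0`.
  have key : ∀ m : ℝ, 0 < m → ‖f z‖ ≤ 2 * m * ‖z - z₀‖ / (R - ‖z - z₀‖) +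
      ‖f z₀‖ * (R + ‖z - z₀‖) / (R - ‖z - z₀‖) := by
    intro m hm
    have h := Complex.borelCaratheodory hm hd (fun w hw => ?_) hR hz'
    · simpa using h
    · have := him _ (hmap hw)
      simp only [Set.mem_ofPred_eq, Complex.mul_re, Complex.I_re, Complex.I_im]
      linarith
  have hc : Continuous fun m : ℝ => 2 * m * ‖z - z₀‖ / (R - ‖z - z₀‖) +
      ‖f z₀‖ * (R + ‖z - z₀‖) / (R - ‖z - z₀‖) := by fun_prop
  have hlim := (hc.tendsto 0).mono_left (nhdsWithin_le_nhds (s := Set.Ioi 0))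
  simp only [mul_zero, zero_mul, zero_div, zero_add] at hlim
  refine ge_of_tendsto hlim ?_
  filter_upwards [self_mem_nhdsWithin] with m hm using key m hm

section Dissipative

variable {H : Type*} [NormedAddCommGroup H] [InnerProductSpace ℂ H] [CompleteSpace H]

/-- The norm of an operator is at most twice its numerical radius. -/
theorem ContinuousLinearMap.opNorm_le_of_inner_self (T : H →L[ℂ] H) {c : ℝ} (hc : 0 ≤ c)
    (h : ∀ x, ‖⟪x, T x⟫_ℂ‖ ≤ c * ‖x‖ ^ 2) : ‖T‖ ≤ 2 * c := by
  refine T.opNorm_le_bound (by positivity) fun y => ?_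
  have h' : ∀ x, ‖⟪T x, x⟫_ℂ‖ ≤ c * ‖x‖ ^ 2 := fun x => by rw [norm_inner_symm]; exact h x
  rcases eq_or_ne (T y) 0 with h0 | h0
  · rw [h0, norm_zero]; positivity
  have ha : 0 < ‖T y‖ := norm_pos_iff.2 h0
  have hy : 0 < ‖y‖ := norm_pos_iff.2 fun hy => h0 (by simp [hy])
  -- `T y` rescaled to the norm of `y`: the pairing with `T y` is then `‖y‖‖T y‖`, and by the
  -- parallelogram law the four squares in the polarization identity add up to `8‖y‖²`.
  set x : H := ((‖y‖ / ‖T y‖ : ℝ) : ℂ) • T y with hx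
  have hxn : ‖x‖ = ‖y‖ := by
    rw [hx, norm_smul, Complex.norm_real, Real.norm_of_nonneg (by positivity)]
    field_simp
  have hin : ‖⟪T y, x⟫_ℂ‖ = ‖y‖ * ‖T y‖ := by
    rw [hx, inner_smul_right, inner_self_eq_norm_sq_to_K, norm_mul, Complex.norm_real,
      Real.norm_of_nonneg (by positivity), norm_pow]
    simp
    field_simp
  have hpol : ‖⟪T y, x⟫_ℂ‖ ≤ c * (‖x + y‖ ^ 2 + ‖x - y‖ ^ 2 + ‖x + Complex.I • y‖ ^ 2 +
      ‖x - Complex.I • y‖ ^ 2) / 4 := by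
    have := inner_map_polarization (T : H →ₗ[ℂ] H) x y
    simp only [ContinuousLinearMap.coe_coe] at this
    rw [this, norm_div, Complex.norm_ofNat]
    gcongr
    refine (norm_sub_le _ _).trans ?_
    have h1 := norm_add_le (⟪T (x + y), x + y⟫_ℂ - ⟪T (x - y), x - y⟫_ℂ)
      (Complex.I * ⟪T (x + Complex.I • y), x + Complex.I • y⟫_ℂ)
    have h2 := norm_sub_le (⟪T (x + y), x + y⟫_ℂ) (⟪T (x - y), x - y⟫_ℂ)
    rw [norm_mul, Complex.norm_I, one_mul] at h1 ⊢
    linarith [h' (x + y), h' (x - y), h' (x + Complex.I • y), h' (x - Complex.I • y)]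
  have hp1 := parallelogram_law_with_norm ℂ x y
  have hp2 := parallelogram_law_with_norm ℂ x (Complex.I • y)
  have hI : ‖Complex.I • y‖ = ‖y‖ := by simp [norm_smul]
  rw [hI] at hp2
  rw [hin] at hpol
  rw [hxn] at hp1 hp2
  have h3 : ‖y‖ * ‖T y‖ ≤ ‖y‖ * (2 * c * ‖y‖) := by
    calc _ ≤ _ := hpol
      _ = c * (8 * (‖y‖ * ‖y‖)) / 4 := by
        congr 2
        nlinarith
      _ = _ := by ring
  exact le_of_mul_le_mul_left h3 hy

theorem IsOperatorHerglotz.isDissipative {M : ℂ → H →L[ℂ] H} (hM : IsOperatorHerglotz M)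
    {z : ℂ} (hz : 0 < z.im) : IsDissipative (M z) :=
  (imaginaryPart_nonneg_iff _).1 (hM.im_nonneg z hz)

theorem IsOperatorHerglotz.differentiableAt {M : ℂ → H →L[ℂ] H} (hM : IsOperatorHerglotz M)
    {z : ℂ} (hz : 0 < z.im) : DifferentiableAt ℂ M z :=
  hM.differentiableOn.differentiableAt (isOpen_im_pos.mem_nhds hz)

theorem IsDissipative.im_inner_inverse_nonpos {T : H →L[ℂ] H} (hT : IsDissipative T)
    (hu : IsUnit T) (x : H) : (⟪x, Ring.inverse T x⟫_ℂ).im ≤ 0 := by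
  have h := hT (Ring.inverse T x)
  rw [apply_inverse hu] at h
  have h2 : (⟪Ring.inverse T x, x⟫_ℂ).im = -(⟪x, Ring.inverse T x⟫_ℂ).im :=
    inner_im_symm (𝕜 := ℂ) _ _
  linarith

/-- For `ε > 0` the operators `M(w) + iε` are invertible throughout the disc, and `-⟪x, (M(w) +
iε)⁻¹ x⟫` has nonnegative imaginary part. Harnack bounds it at `z` by its value at `z₀`, which is
controlled independently of `ε`; hence `iε` is a small perturbation for small `ε`. -/
theorem IsOperatorHerglotz.isUnit_of_mem_ball {M : ℂ → H →L[ℂ] H} (hM : IsOperatorHerglotz M)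
    {z₀ z : ℂ} (hz₀ : 0 < z₀.im) (hu : IsUnit (M z₀)) (hz : z ∈ Metric.ball z₀ z₀.im) :
    IsUnit (M z) := by
  have hzd : 0 < z₀.im - ‖z - z₀‖ := by
    rw [Metric.mem_ball, dist_eq_norm] at hz; linarith
  set k : ℝ := (z₀.im + ‖z - z₀‖) / (z₀.im - ‖z - z₀‖) with hk
  have hk0 : 0 ≤ k := by positivity
  set B : ℝ := 1 + 2 * ‖Ring.inverse (M z₀)‖ with hB
  have hB0 : 0 < B := by positivity
  have hbound : ∀ ε : ℝ, 0 < ε →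
      ‖Ring.inverse (M z + (Complex.I * (ε : ℂ)) • (1 : H →L[ℂ] H))‖ ≤ 2 * (B * k) := by
    intro ε hε
    have hunit : ∀ w : ℂ, 0 < w.im → IsUnit (M w + (Complex.I * (ε : ℂ)) • (1 : H →L[ℂ] H)) :=
      fun w hw => (hM.isDissipative hw).isUnit_add (by simpa using hε)
    refine ContinuousLinearMap.opNorm_le_of_inner_self _ (by positivity) fun x => ?_
    let f : ℂ → ℂ := fun w =>
      -⟪x, Ring.inverse (M w + (Complex.I * (ε : ℂ)) • (1 : H →L[ℂ] H)) x⟫_ℂ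
    have hfd : DifferentiableOn ℂ f (Metric.ball z₀ z₀.im) := by
      intro w hw
      have hw' := im_pos_of_mem_ball hw
      refine DifferentiableAt.differentiableWithinAt (DifferentiableAt.neg ?_)
      have h1 : DifferentiableAt ℂ (fun w => Ring.inverse (M w +
          (Complex.I * (ε : ℂ)) • (1 : H →L[ℂ] H))) w :=
        DifferentiableAt.comp (g := Ring.inverse) w (differentiableAt_inverse (hunit w hw'))
          ((hM.differentiableAt hw').add_const _)
      exact ((innerSL ℂ x).comp (ContinuousLinearMap.apply ℂ H x)).differentiableAt.comp w h1
    have hfi : ∀ w ∈ Metric.ball z₀ z₀.im, 0 ≤ (f w).im := by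
      intro w hw
      have hw' := im_pos_of_mem_ball hw
      have := ((hM.isDissipative hw').add (w := Complex.I * ε)
        (by simpa using hε.le)).im_inner_inverse_nonpos (hunit w hw') x
      simpa [f] using this
    have h := norm_le_of_im_nonneg_on_ball hz₀ hfd hfi hz
    simp only [f, norm_neg] at h
    refine h.trans ?_
    rw [mul_div_assoc, ← hk]
    have h1 : ‖⟪x, Ring.inverse (M z₀ + (Complex.I * (ε : ℂ)) • (1 : H →L[ℂ] H)) x⟫_ℂ‖ ≤
        ‖x‖ * (B * ‖x‖) := by
      refine (norm_inner_le_norm _ _).trans ?_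
      gcongr
      refine (ContinuousLinearMap.le_opNorm _ _).trans ?_
      gcongr
      refine ((hM.isDissipative hz₀).norm_inverse_add_I_mul_le hu hε.le).trans ?_
      exact div_le_self hB0.le (by linarith)
    calc _ ≤ ‖x‖ * (B * ‖x‖) * k := by gcongr
      _ = _ := by ring
  -- Chosen so that `ε · 2Bk < 1`, which makes the Neumann series of `1 - iε S⁻¹` converge.
  set ε : ℝ := (2 * (B * k) + 1)⁻¹ with hε
  have hε0 : 0 < ε := by positivity
  have hz' := im_pos_of_mem_ball hz
  have hS : IsUnit (M z + (Complex.I * (ε : ℂ)) • (1 : H →L[ℂ] H)) :=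
    (hM.isDissipative hz').isUnit_add (by simpa using hε0)
  set S := M z + (Complex.I * (ε : ℂ)) • (1 : H →L[ℂ] H) with hSdef
  have hlt : ‖(Complex.I * (ε : ℂ)) • Ring.inverse S‖ < 1 := by
    rw [norm_smul, norm_mul, Complex.norm_I, one_mul, Complex.norm_real,
      Real.norm_of_nonneg hε0.le]
    calc ε * ‖Ring.inverse S‖ ≤ ε * (2 * (B * k)) := by gcongr; exact hbound ε hε0
      _ < ε * (2 * (B * k) + 1) := by gcongr; linarith
      _ = 1 := inv_mul_cancel₀ (by positivity)
  have hfac : M z = S * (1 - (Complex.I * (ε : ℂ)) • Ring.inverse S) := by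
    rw [mul_sub, mul_one, mul_smul_comm, Ring.mul_inverse_cancel S hS, hSdef]
    abel
  rw [hfac]
  exact hS.mul (isUnit_one_sub_of_norm_lt_one hlt)

theorem IsOperatorHerglotz.isUnit {M : ℂ → H →L[ℂ] H} (hM : IsOperatorHerglotz M)
    (hinv : ∃ z₀ : ℂ, 0 < z₀.im ∧ IsUnit (M z₀)) {z : ℂ} (hz : 0 < z.im) : IsUnit (M z) := by
  obtain ⟨z₀, hz₀, hu⟩ := hinv
  have hpre : IsPreconnected {z : ℂ | 0 < z.im} :=
    (convex_halfSpace_im_gt 0).isPreconnected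
  have hopen : IsOpen {z : ℂ | 0 < z.im ∧ IsUnit (M z)} := by
    refine Metric.isOpen_iff.2 fun w hw => ⟨w.im, hw.1, fun v hv => ?_⟩
    exact ⟨im_pos_of_mem_ball hv, hM.isUnit_of_mem_ball hw.1 hw.2 hv⟩
  refine (hpre.subset_of_closure_inter_subset hopen ⟨z₀, hz₀, hz₀, hu⟩ ?_ hz).2
  rintro w ⟨hw1, hw2⟩
  -- A point `v` closer than `Im w / 2` has `Im v > Im w / 2`, so its disc of radius `Im v` contains
  -- `w`.
  obtain ⟨v, hv, hvw⟩ := Metric.mem_closure_iff.1 hw1 (w.im / 2) (half_pos hw2)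
  refine ⟨hw2, hM.isUnit_of_mem_ball hv.1 hv.2 ?_⟩
  rw [Metric.mem_ball]
  have h1 := Complex.abs_im_le_norm (w - v)
  rw [← dist_eq_norm] at h1
  have h2 := (abs_le.1 h1).2
  rw [Complex.sub_im] at h2
  linarith

/-- Differentiation under the integral: the derivative `-R M' R` of the integrand contains two
resolvents `R`, each of order `1/(1 + s)` locally uniformly in `z`. -/
theorem differentiableAt_operatorLog_comp {M : ℂ → H →L[ℂ] H} (hM : IsOperatorHerglotz M)
    (hu : ∀ z : ℂ, 0 < z.im → IsUnit (M z)) {z₀ : ℂ} (hz₀ : 0 < z₀.im) :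
    DifferentiableAt ℂ (fun z => operatorLog (M z)) z₀ := by
  simp only [operatorLog_eq]
  suffices h : DifferentiableAt ℂ
      (fun z => ∫ s in Set.Ioi (0 : ℝ), logIntegrand (M z) s) z₀ from h.const_smul (-Complex.I)
  set B : ℝ := ‖Ring.inverse (M z₀)‖ + 1 with hB
  set D : ℝ := ‖deriv M z₀‖ + 1 with hD
  have hdM : DifferentiableOn ℂ (deriv M) {z : ℂ | 0 < z.im} :=
    hM.differentiableOn.deriv isOpen_im_pos
  have hnhds : {z : ℂ | 0 < z.im ∧ ‖Ring.inverse (M z)‖ < B ∧ ‖deriv M z‖ < D} ∈ 𝓝 z₀ := by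
    have h1 : ContinuousAt (fun z => ‖Ring.inverse (M z)‖) z₀ :=
      ((continuousAt_inverse_of_isUnit (hu z₀ hz₀)).comp
        (hM.differentiableAt hz₀).continuousAt).norm
    have h2 : ContinuousAt (fun z => ‖deriv M z‖) z₀ :=
      (hdM.differentiableAt (isOpen_im_pos.mem_nhds hz₀)).continuousAt.norm
    filter_upwards [isOpen_im_pos.mem_nhds hz₀, h1.eventually (gt_mem_nhds (lt_add_one _)),
      h2.eventually (gt_mem_nhds (lt_add_one _))] with z ha hb hc using ⟨ha, hb, hc⟩
  let R : ℂ → ℝ → H →L[ℂ] H := fun z s =>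
    Ring.inverse (M z + (Complex.I * (s : ℂ)) • (1 : H →L[ℂ] H))
  refine (hasDerivAt_integral_of_dominated_loc_of_deriv_le
    (F' := fun z s => -(R z s * deriv M z * R z s))
    (bound := fun s => (1 + 2 * B) ^ 2 * D * (1 + s ^ 2)⁻¹) hnhds ?_ ?_ ?_ ?_ ?_ ?_).2.differentiableAt
  · filter_upwards [isOpen_im_pos.mem_nhds hz₀] with z hz
    exact (hM.isDissipative hz).aestronglyMeasurable_logIntegrand (hu z hz)
  · exact (hM.isDissipative hz₀).integrableOn_logIntegrand (hu z₀ hz₀)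
  · refine ContinuousOn.aestronglyMeasurable ?_ measurableSet_Ioi
    have := ((hM.isDissipative hz₀).continuousOn_inverse_add_I_mul (hu z₀ hz₀)).mono
      Set.Ioi_subset_Ici_self
    exact ((this.mul continuousOn_const).mul this).neg
  · refine (ae_restrict_iff' measurableSet_Ioi).2 (Eventually.of_forall fun s hs z hz => ?_)
    have hs' : 0 ≤ s := le_of_lt hs
    have h1 : ‖R z s‖ ≤ (1 + 2 * B) / (1 + s) :=
      ((hM.isDissipative hz.1).norm_inverse_add_I_mul_le (hu z hz.1) hs').trans (by
        gcongr; exact hz.2.1.le)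
    rw [norm_neg]
    calc ‖R z s * deriv M z * R z s‖ ≤ ‖R z s‖ * ‖deriv M z‖ * ‖R z s‖ :=
          (norm_mul_le _ _).trans (by gcongr; exact norm_mul_le _ _)
      _ ≤ (1 + 2 * B) / (1 + s) * D * ((1 + 2 * B) / (1 + s)) := by
          gcongr; exact hz.2.2.le
      _ = (1 + 2 * B) ^ 2 * D * ((1 + s) ^ 2)⁻¹ := by field_simp
      _ ≤ _ := by gcongr; nlinarith
  · exact (integrable_inv_one_add_sq.const_mul _).integrableOn
  · refine (ae_restrict_iff' measurableSet_Ioi).2 (Eventually.of_forall fun s hs z hz => ?_)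
    obtain ⟨u, hu'⟩ := (hM.isDissipative hz.1).isUnit_add_I_mul (hu z hz.1) (le_of_lt hs)
    have h1 : HasDerivAt (fun z => M z + (Complex.I * (s : ℂ)) • (1 : H →L[ℂ] H))
        (deriv M z) z := (hM.differentiableAt hz.1).hasDerivAt.add_const _
    have h2 := hasFDerivAt_ringInverse (𝕜 := ℂ) u
    rw [hu'] at h2
    have h3 := (h2.comp_hasDerivAt z h1).sub_const
      (((1 + Complex.I * (s : ℂ))⁻¹) • (1 : H →L[ℂ] H))
    refine h3.congr_deriv ?_
    simp [R, ← hu']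

end Dissipative

/-! ### Scalar integral representation: weak compactness, Schwarz's formula, Cayley transform. -/

/-- Weak sequential compactness of order intervals `[0, c]` of measurable functions with respect to
a finite measure, along an ultrafilter. -/
theorem exists_weak_limit_of_bounded {α : Type*} [MeasurableSpace α] {μ : Measure α}
    [IsFiniteMeasure μ] {ι : Type*} (U : Ultrafilter ι) {u : ι → α → ℝ} {c : ℝ}
    (hc : 0 ≤ c) (hm : ∀ n, AEStronglyMeasurable (u n) μ) (hu : ∀ n t, 0 ≤ u n t ∧ u n t ≤ c) :
    ∃ ξ : α → ℝ, Measurable ξ ∧ (∀ t, 0 ≤ ξ t ∧ ξ t ≤ c) ∧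
      ∀ g : α → ℝ, MemLp g 2 μ →
        Tendsto (fun n => ∫ t, u n t * g t ∂μ) U (𝓝 (∫ t, ξ t * g t ∂μ)) := by
  have hmem : ∀ n, MemLp (u n) 2 μ := fun n => MemLp.of_bound (hm n) c
    (Eventually.of_forall fun t => by
      rw [Real.norm_of_nonneg (hu n t).1]; exact (hu n t).2)
  let v : ι → Lp ℝ 2 μ := fun n => (hmem n).toLp
  let B : ℝ := (μ.real Set.univ) ^ (2 : ENNReal).toReal⁻¹ * c
  have hv : ∀ n, ‖v n‖ ≤ B := by
    intro n
    refine Lp.norm_le_of_ae_bound hc ?_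
    filter_upwards [(hmem n).coeFn_toLp] with t ht
    rw [ht, Real.norm_of_nonneg (hu n t).1]; exact (hu n t).2
  -- Riesz duality places the bounded sequence in a ball of the weak dual, where Banach–Alaoglu
  -- gives the limit.
  let φ : ι → WeakDual ℝ (Lp ℝ 2 μ) := fun n =>
    StrongDual.toWeakDual (InnerProductSpace.toDual ℝ (Lp ℝ 2 μ) (v n))
  have hφ : ∀ n, φ n ∈ WeakDual.toStrongDual ⁻¹'
      Metric.closedBall (0 : StrongDual ℝ (Lp ℝ 2 μ)) B := by
    intro n
    simp only [Set.mem_preimage, mem_closedBall_zero_iff]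
    exact ((InnerProductSpace.toDual ℝ (Lp ℝ 2 μ)).norm_map (v n)).le.trans (hv n)
  obtain ⟨ψ, -, hψ⟩ := (WeakDual.isCompact_closedBall (0 : StrongDual ℝ (Lp ℝ 2 μ)) B).ultrafilter_le_nhds
    (U.map φ) (by
      rw [le_principal_iff]
      exact Filter.mem_map.2 (Filter.univ_mem' hφ))
  have hψ' : Tendsto φ U (𝓝 ψ) := hψ
  let w : Lp ℝ 2 μ := (InnerProductSpace.toDual ℝ (Lp ℝ 2 μ)).symm (WeakDual.toStrongDual ψ)
  have hw : ∀ g : Lp ℝ 2 μ, Tendsto (fun n => ⟪v n, g⟫_ℝ) U (𝓝 ⟪w, g⟫_ℝ) := by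
    intro g
    have h1 := ((WeakDual.eval_continuous g).tendsto ψ).comp hψ'
    have h2 : ⟪w, g⟫_ℝ = ψ g := by
      have := InnerProductSpace.toDual_symm_apply (𝕜 := ℝ) (x := g) (y := WeakDual.toStrongDual ψ)
      exact this
    rw [h2]
    exact h1
  have hlim : ∀ g : α → ℝ, MemLp g 2 μ →
      Tendsto (fun n => ∫ t, u n t * g t ∂μ) U (𝓝 (∫ t, w t * g t ∂μ)) := by
    intro g hg
    have h1 := hw (hg.toLp g)
    simp only [L2.inner_def] at h1
    have h2 : ∫ t, ⟪w t, (hg.toLp g : Lp ℝ 2 μ) t⟫_ℝ ∂μ = ∫ t, w t * g t ∂μ := by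
      refine integral_congr_ae ?_
      filter_upwards [hg.coeFn_toLp] with t ht
      rw [ht]
      simp [mul_comm]
    have h3 : ∀ n, ∫ t, ⟪v n t, (hg.toLp g : Lp ℝ 2 μ) t⟫_ℝ ∂μ = ∫ t, u n t * g t ∂μ := by
      intro n
      refine integral_congr_ae ?_
      filter_upwards [hg.coeFn_toLp, (hmem n).coeFn_toLp] with t ht ht2
      rw [ht, ht2]
      simp [mul_comm]
    rw [h2] at h1
    simpa only [h3] using h1
  have hwint : Integrable w μ := (Lp.memLp w).integrable one_le_two
  have huint : ∀ n, Integrable (u n) μ := fun n => (hmem n).integrable one_le_two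
  have hset : ∀ s, MeasurableSet s →
      Tendsto (fun n => ∫ t in s, u n t ∂μ) U (𝓝 (∫ t in s, w t ∂μ)) := by
    intro s hs
    have h1 := hlim (s.indicator fun _ => 1) (memLp_indicator_const 2 hs 1 (Or.inr (by simp)))
    have h2 : ∀ f : α → ℝ, (fun t => f t * s.indicator (fun _ => 1) t) = s.indicator f := by
      intro f
      ext t
      by_cases ht : t ∈ s <;> simp [ht]
    simpa only [h2, integral_indicator hs] using h1
  have h0 : 0 ≤ᵐ[μ] w := by
    refine ae_nonneg_of_forall_setIntegral_nonneg hwint fun s hs _ => ?_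
    exact ge_of_tendsto' (hset s hs) fun n => integral_nonneg fun t => (hu n t).1
  have h1 : w ≤ᵐ[μ] fun _ => c := by
    have : 0 ≤ᵐ[μ] fun t => c - w t := by
      refine ae_nonneg_of_forall_setIntegral_nonneg ((integrable_const c).sub hwint)
        fun s hs _ => ?_
      have h2 := (hset s hs).const_sub (∫ _t in s, c ∂μ)
      rw [← integral_sub (integrable_const c).integrableOn hwint.integrableOn] at h2
      refine ge_of_tendsto' h2 fun n => ?_
      rw [← integral_sub (integrable_const c).integrableOn (huint n).integrableOn]
      exact integral_nonneg fun t => sub_nonneg.2 (hu n t).2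
    filter_upwards [this] with t ht
    simpa using ht
  -- The weak limit lies in `[0, c]` only almost everywhere; truncation makes the bounds hold at
  -- every point.
  refine ⟨fun t => max 0 (min c (w t)), ?_, fun t => ⟨le_max_left _ _, ?_⟩, fun g hg => ?_⟩
  · exact measurable_const.max (measurable_const.min (Lp.stronglyMeasurable w).measurable)
  · exact max_le hc (min_le_left _ _)
  · convert hlim g hg using 2
    refine integral_congr_ae ?_
    filter_upwards [h0, h1] with t ht1 ht2
    rw [min_eq_right ht2, max_eq_right (show (0 : ℝ) ≤ w t from ht1)]

/-- Schwarz's integral formula. -/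
theorem DiffContOnCl.eq_re_add_circleAverage_im {F : ℂ → ℂ} {R : ℝ} (hR : 0 < R)
    (hF : DiffContOnCl ℂ F (Metric.ball 0 R)) {w : ℂ} (hw : w ∈ Metric.ball (0 : ℂ) R) :
    F w = (F 0).re + Complex.I *
      Real.circleAverage (fun ζ => (ζ + w) / (ζ - w) * ((F ζ).im : ℂ)) 0 R := by
  have hcl : ContinuousOn F (Metric.sphere 0 R) := by
    refine hF.continuousOn.mono ?_
    rw [closure_ball 0 hR.ne']
    exact Metric.sphere_subset_closedBall
  have hne : ∀ ζ ∈ Metric.sphere (0 : ℂ) R, ζ - w ≠ 0 := by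
    intro ζ hζ h
    rw [sub_eq_zero] at h
    rw [mem_sphere_zero_iff_norm, h] at hζ
    rw [mem_ball_zero_iff] at hw
    linarith
  have hkc : ContinuousOn (fun ζ : ℂ => (ζ + w) / (ζ - w)) (Metric.sphere 0 R) :=
    ContinuousOn.div (by fun_prop) (by fun_prop) hne
  have hci : ∀ g : ℂ → ℂ, ContinuousOn g (Metric.sphere 0 R) → CircleIntegrable g 0 R :=
    fun g hg => hg.circleIntegrable hR.le
  have hFc : DiffContOnCl ℂ F (Metric.ball 0 |R|) := by rwa [abs_of_pos hR]
  have hwc : w ∈ Metric.ball (0 : ℂ) |R| := by rwa [abs_of_pos hR]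
  -- Write `k = (ζ + w)/(ζ - w) = 2ζ/(ζ - w) - 1`. Cauchy's formula averages `k F` to `2F(w) -
  -- F(0)`, and Poisson's averages `(Re k) F` to `F(w)`. Hence `(conj k) F` averages to `F(0)`, so
  -- `k (conj F)` averages to `conj F(0)`. Subtracting isolates `k Im F`.
  have e0 : Real.circleAverage F 0 R = F 0 := hFc.circleAverage
  have e1 : Real.circleAverage (fun ζ => (ζ / (ζ - w)) * F ζ) 0 R = F w := by
    simpa using hFc.circleAverage_smul_div hwc
  have e2 : Real.circleAverage (fun ζ => (((ζ + w) / (ζ - w)).re : ℂ) * F ζ) 0 R = F w := by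
    simpa using hF.circleAverage_re_herglotzRieszKernel_smul' hw
  have e3 : Real.circleAverage (fun ζ => (ζ + w) / (ζ - w) * F ζ) 0 R = 2 * F w - F 0 := by
    have : Set.EqOn (fun ζ => (ζ + w) / (ζ - w) * F ζ)
        (fun ζ => (2 : ℂ) • ((ζ / (ζ - w)) * F ζ) - F ζ) (Metric.sphere 0 |R|) := by
      intro ζ hζ
      rw [abs_of_pos hR] at hζ
      have := hne ζ hζ
      simp only [smul_eq_mul]
      field_simp
      ring
    rw [Real.circleAverage_congr_sphere this, Real.circleAverage_fun_sub, e0,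
      Real.circleAverage_fun_smul, e1]
    · simp
    · refine hci _ (ContinuousOn.fun_const_smul (ContinuousOn.fun_mul ?_ hcl) _)
      exact ContinuousOn.div (by fun_prop) (by fun_prop) hne
    · exact hci _ hcl
  have e4 : Real.circleAverage (fun ζ => (starRingEnd ℂ) ((ζ + w) / (ζ - w)) * F ζ) 0 R = F 0 := by
    have : (fun ζ => (starRingEnd ℂ) ((ζ + w) / (ζ - w)) * F ζ) =
        (fun ζ => (2 : ℂ) • ((((ζ + w) / (ζ - w)).re : ℂ) * F ζ) - (ζ + w) / (ζ - w) * F ζ) := by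
      ext ζ
      rw [smul_eq_mul, ← mul_assoc, ← sub_mul]
      congr 1
      have := Complex.add_conj ((ζ + w) / (ζ - w))
      push_cast at this
      linear_combination this
    rw [this, Real.circleAverage_fun_sub, Real.circleAverage_fun_smul, e2, e3]
    · simp
    · refine hci _ (ContinuousOn.fun_const_smul (ContinuousOn.fun_mul ?_ hcl) _)
      exact Complex.continuous_ofReal.comp_continuousOn
        (Complex.continuous_re.comp_continuousOn hkc)
    · exact hci _ (hkc.mul hcl)
  have e5 : Real.circleAverage (fun ζ => (ζ + w) / (ζ - w) * (starRingEnd ℂ) (F ζ)) 0 R =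
      (starRingEnd ℂ) (F 0) := by
    rw [← e4]
    have := (Complex.conjCLE : ℂ →L[ℝ] ℂ).circleAverage_comp_comm
      (f := fun ζ => (starRingEnd ℂ) ((ζ + w) / (ζ - w)) * F ζ) (c := 0) (R := R)
      (hci _ (ContinuousOn.mul (Complex.continuous_conj.comp_continuousOn hkc) hcl))
    rw [← Complex.conjCLE_apply, ← ContinuousLinearEquiv.coe_coe, ← this]
    congr 1
    ext ζ
    simp
  have e6 : Real.circleAverage (fun ζ => (ζ + w) / (ζ - w) * ((F ζ).im : ℂ)) 0 R =
      (2 * Complex.I)⁻¹ * (2 * F w - F 0 - (starRingEnd ℂ) (F 0)) := by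
    rw [← e3, ← e5]
    rw [← Real.circleAverage_fun_sub (hci _ (hkc.fun_mul hcl))
      (hci _ (hkc.fun_mul (Complex.continuous_conj.comp_continuousOn' hcl))), ← smul_eq_mul,
      ← Real.circleAverage_fun_smul]
    congr 1
    ext ζ
    rw [← mul_sub, Complex.sub_conj, smul_eq_mul]
    field_simp
    push_cast
    ring
  rw [e6]
  have := Complex.add_conj (F 0)
  have hI : Complex.I ≠ 0 := Complex.I_ne_zero
  field_simp
  push_cast at this
  linear_combination this

/-- The half-angle substitution: `θ = 2 arctan t` parametrizes the circle minus `-1` by the boundary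
line of the half-plane under the Cayley transform. -/
theorem circleMap_two_mul_arctan (t : ℝ) :
    circleMap 0 1 (2 * Real.arctan t) = (Complex.I - t) / (Complex.I + t) := by
  have hne : Complex.I + (t : ℂ) ≠ 0 := by
    intro h
    simpa using congrArg Complex.im h
  have h1 : circleMap 0 1 (2 * Real.arctan t) =
      ((Real.cos (Real.arctan t) : ℂ) + Real.sin (Real.arctan t) * Complex.I) ^ 2 := by
    rw [circleMap, Complex.ofReal_cos, Complex.ofReal_sin, ← Complex.exp_mul_I, ← Complex.exp_nat_mul]
    simp
    ring_nf
  have hpos : 0 < 1 + t ^ 2 := by positivity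
  have h2 : ((√(1 + t ^ 2) : ℝ) : ℂ) ^ 2 = (1 + t ^ 2 : ℂ) := by
    rw [← Complex.ofReal_pow, Real.sq_sqrt hpos.le]
    push_cast
    rfl
  have h3 : ((√(1 + t ^ 2) : ℝ) : ℂ) ≠ 0 := by
    rw [Complex.ofReal_ne_zero]
    positivity
  rw [h1, Real.cos_arctan, Real.sin_arctan]
  push_cast
  have h4 : ((1 / (√(1 + t ^ 2) : ℝ) : ℂ) + t / (√(1 + t ^ 2) : ℝ) * Complex.I) ^ 2 =
      (1 + t * Complex.I) ^ 2 / (√(1 + t ^ 2) : ℝ) ^ 2 := by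
    field_simp
  rw [h4, h2, div_eq_div_iff (by rw [← h2]; exact pow_ne_zero _ h3) hne]
  linear_combination (2 * (t : ℂ) + t ^ 2 * Complex.I + t ^ 3) * Complex.I_sq

theorem integral_Ioo_neg_pi_pi_eq {E : Type*} [NormedAddCommGroup E] [NormedSpace ℝ E]
    (g : ℝ → E) : ∫ θ in Set.Ioo (-Real.pi) Real.pi, g θ =
      ∫ t : ℝ, (2 / (1 + t ^ 2)) • g (2 * Real.arctan t) := by
  have himg : (fun t => 2 * Real.arctan t) '' Set.univ = Set.Ioo (-Real.pi) Real.pi := by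
    ext θ
    constructor
    · rintro ⟨t, -, rfl⟩
      have h1 := Real.neg_pi_div_two_lt_arctan t
      have h2 := Real.arctan_lt_pi_div_two t
      constructor <;> simp only <;> linarith
    · rintro ⟨h1, h2⟩
      refine ⟨Real.tan (θ / 2), trivial, ?_⟩
      simp only
      rw [Real.arctan_tan (by linarith) (by linarith)]
      ring
  have hd : ∀ t ∈ (Set.univ : Set ℝ), HasDerivWithinAt (fun t => 2 * Real.arctan t)
      (2 / (1 + t ^ 2)) Set.univ t := by
    intro t _
    have := ((Real.hasDerivAt_arctan t).const_mul 2).hasDerivWithinAt (s := Set.univ)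
    exact this.congr_deriv (by ring)
  have hinj : Set.InjOn (fun t => 2 * Real.arctan t) Set.univ := by
    intro a _ b _ h
    exact Real.arctan_injective (by simpa using h)
  rw [← himg, integral_image_eq_integral_abs_deriv_smul MeasurableSet.univ hd hinj,
    setIntegral_univ]
  refine integral_congr_ae (Eventually.of_forall fun t => ?_)
  have : 0 ≤ 2 / (1 + t ^ 2) := by positivity
  simp only [abs_of_nonneg this]

theorem circleAverage_eq_integral_Ioo {E : Type*} [NormedAddCommGroup E] [NormedSpace ℝ E]
    (g : ℂ → E) : Real.circleAverage g 0 1 = (2 * Real.pi)⁻¹ •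
      ∫ θ in Set.Ioo (-Real.pi) Real.pi, g (circleMap 0 1 θ) := by
  rw [Real.circleAverage_def]
  congr 1
  have hper : Function.Periodic (fun θ => g (circleMap 0 1 θ)) (2 * Real.pi) :=
    fun θ => by simp only [periodic_circleMap 0 1 θ]
  have := hper.intervalIntegral_add_eq 0 (-Real.pi)
  rw [zero_add] at this
  rw [this, intervalIntegral.integral_of_le (by linarith [Real.pi_pos]), integral_Ioc_eq_integral_Ioo]
  congr 2
  ring_nf

theorem integral_ofReal_mul_eq {α : Type*} [MeasurableSpace α] {μ : Measure α} {u : α → ℝ}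
    {g : α → ℂ} (h : Integrable (fun t => (u t : ℂ) * g t) μ) :
    ∫ t, (u t : ℂ) * g t ∂μ =
      ((∫ t, u t * (g t).re ∂μ : ℝ) : ℂ) + ((∫ t, u t * (g t).im ∂μ : ℝ) : ℂ) * Complex.I := by
  rw [← integral_re_add_im h]
  simp

/-- The Cayley transform of the unit disc onto the upper half-plane. -/
noncomputable def discToHalfPlane (w : ℂ) : ℂ := Complex.I * (1 - w) / (1 + w)

theorem one_add_ne_zero_of_norm_lt {w : ℂ} (hw : ‖w‖ < 1) : 1 + w ≠ 0 := by
  intro h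
  have : w = -1 := by linear_combination h
  simp [this] at hw

theorem discToHalfPlane_im_pos {w : ℂ} (hw : ‖w‖ < 1) : 0 < (discToHalfPlane w).im := by
  have h1 := one_add_ne_zero_of_norm_lt hw
  have h2 : 0 < Complex.normSq (1 + w) := Complex.normSq_pos.2 h1
  have h3 : (discToHalfPlane w).im = (1 - ‖w‖ ^ 2) / Complex.normSq (1 + w) := by
    rw [discToHalfPlane, Complex.div_im, ← Complex.normSq_eq_norm_sq, ← sub_div]
    congr 1
    simp [Complex.normSq_apply]
    ring
  rw [h3]
  have : ‖w‖ ^ 2 < 1 := by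
    have := norm_nonneg w
    nlinarith
  exact div_pos (by linarith) h2

theorem I_add_ne_zero {z : ℂ} (hz : 0 ≤ z.im) : Complex.I + z ≠ 0 := by
  intro h
  have := congrArg Complex.im h
  simp at this
  linarith

theorem norm_halfPlaneToDisc_lt {z : ℂ} (hz : 0 < z.im) :
    ‖(Complex.I - z) / (Complex.I + z)‖ < 1 := by
  rw [norm_div, div_lt_one (norm_pos_iff.2 (I_add_ne_zero hz.le)), Complex.norm_eq_sqrt_sq_add_sq,
    Complex.norm_eq_sqrt_sq_add_sq]
  apply Real.sqrt_lt_sqrt (by positivity)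
  simp
  nlinarith

theorem discToHalfPlane_halfPlaneToDisc {z : ℂ} (hz : 0 ≤ z.im) :
    discToHalfPlane ((Complex.I - z) / (Complex.I + z)) = z := by
  have h := I_add_ne_zero hz
  have h2 : 1 + (Complex.I - z) / (Complex.I + z) = 2 * Complex.I / (Complex.I + z) := by
    field_simp; ring
  rw [discToHalfPlane, h2]
  have hI := Complex.I_ne_zero
  field_simp
  ring

theorem differentiableAt_discToHalfPlane {w : ℂ} (hw : ‖w‖ < 1) :
    DifferentiableAt ℂ discToHalfPlane w :=
  DifferentiableAt.div (by fun_prop) (by fun_prop) (one_add_ne_zero_of_norm_lt hw)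

/-- The Schwarz kernel of the disc, transported to the half-plane. -/
theorem schwarz_kernel_eq {z : ℂ} (hz : 0 < z.im) (t : ℝ) :
    Complex.I * ((((Complex.I - t) / (Complex.I + t)) + (Complex.I - z) / (Complex.I + z)) /
      (((Complex.I - t) / (Complex.I + t)) - (Complex.I - z) / (Complex.I + z))) / (1 + t ^ 2) =
      ((t : ℂ) - z)⁻¹ - (t : ℂ) * (1 + (t : ℂ) ^ 2)⁻¹ := by
  have h1 := I_add_ne_zero hz.le
  have h2 : Complex.I + (t : ℂ) ≠ 0 := I_add_ne_zero (by simp)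
  have h3 : (t : ℂ) - z ≠ 0 := by
    intro h
    have := congrArg Complex.im h
    simp at this
    linarith
  have h4 : (1 : ℂ) + (t : ℂ) ^ 2 ≠ 0 := by
    have : (1 : ℝ) + t ^ 2 ≠ 0 := by positivity
    exact_mod_cast this
  have hI := Complex.I_ne_zero
  have e1 : (Complex.I - t) / (Complex.I + t) + (Complex.I - z) / (Complex.I + z) =
      -2 * (1 + t * z) / ((Complex.I + t) * (Complex.I + z)) := by
    rw [div_add_div _ _ h2 h1]
    congr 1
    linear_combination 2 * Complex.I_sq
  have e2 : (Complex.I - t) / (Complex.I + t) - (Complex.I - z) / (Complex.I + z) =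
      -2 * Complex.I * (t - z) / ((Complex.I + t) * (Complex.I + z)) := by
    rw [div_sub_div _ _ h2 h1]
    congr 1
    ring
  rw [e1, e2, div_div_div_cancel_right₀ (mul_ne_zero h2 h1)]
  field_simp
  ring

/-- Representation of a holomorphic function with bounded nonnegative imaginary part on the upper
half-plane. -/
theorem exists_density_of_im_bounded {f : ℂ → ℂ} (hf : DifferentiableOn ℂ f {z : ℂ | 0 < z.im})
    {c : ℝ} (hc : 0 ≤ c)
    (hb : ∀ z : ℂ, 0 < z.im → 0 ≤ (f z).im ∧ (f z).im ≤ Real.pi * c) :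
    ∃ ξ : ℝ → ℝ, Measurable ξ ∧ (∀ t, 0 ≤ ξ t ∧ ξ t ≤ c) ∧ ∀ z : ℂ, 0 < z.im →
      f z = (f Complex.I).re +
        ∫ t : ℝ, (ξ t : ℂ) * (((t : ℂ) - z)⁻¹ - (t : ℂ) * (1 + (t : ℂ) ^ 2)⁻¹) := by
  have hπ := Real.pi_pos
  let F : ℂ → ℂ := fun w => f (discToHalfPlane w)
  have hF : ∀ w : ℂ, ‖w‖ < 1 → DifferentiableAt ℂ F w := fun w hw =>
    DifferentiableAt.comp w
      (hf.differentiableAt (isOpen_im_pos.mem_nhds (discToHalfPlane_im_pos hw)))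
      (differentiableAt_discToHalfPlane hw)
  have hFb : ∀ w : ℂ, ‖w‖ < 1 → 0 ≤ (F w).im ∧ (F w).im ≤ Real.pi * c :=
    fun w hw => hb _ (discToHalfPlane_im_pos hw)
  -- `F` need not extend to the unit circle, so Schwarz's formula is applied to `ζ ↦ F (r n * ζ)`,
  -- which is holomorphic on a neighbourhood of the closed disc.
  let r : ℕ → ℝ := fun n => 1 - 1 / ((n : ℝ) + 1)
  have hr0 : ∀ n, 0 ≤ r n := fun n => by
    have : 1 / ((n : ℝ) + 1) ≤ 1 := by
      rw [div_le_one (by positivity)]; linarith [(Nat.cast_nonneg n : (0 : ℝ) ≤ n)]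
    simp only [r]; linarith
  have hr1 : ∀ n, r n < 1 := fun n => by
    have : 0 < 1 / ((n : ℝ) + 1) := by positivity
    simp only [r]; linarith
  have hrlim : Tendsto r atTop (𝓝 1) := by
    simpa [r] using tendsto_one_div_add_atTop_nhds_zero_nat.const_sub (1 : ℝ)
  have hrn : ∀ n (ζ : ℂ), ‖ζ‖ ≤ 1 → ‖(r n : ℂ) * ζ‖ < 1 := by
    intro n ζ hζ
    rw [norm_mul, Complex.norm_real, Real.norm_of_nonneg (hr0 n)]
    nlinarith [hr0 n, hr1 n, norm_nonneg ζ]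
  have hFr : ∀ n (ζ : ℂ), ‖ζ‖ ≤ 1 → DifferentiableAt ℂ (fun ζ => F ((r n : ℂ) * ζ)) ζ :=
    fun n ζ hζ => DifferentiableAt.comp (g := F) ζ (hF _ (hrn n ζ hζ)) (by fun_prop)
  let u : ℕ → ℝ → ℝ := fun n θ => (F ((r n : ℂ) * circleMap 0 1 θ)).im / Real.pi
  have hcm : ∀ θ, ‖circleMap 0 1 θ‖ = 1 := fun θ => by simp
  have hucont : ∀ n, Continuous (u n) := by
    intro n
    have : Continuous fun θ => F ((r n : ℂ) * circleMap 0 1 θ) :=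
      continuous_iff_continuousAt.2 fun θ =>
        ContinuousAt.comp (g := fun ζ => F ((r n : ℂ) * ζ)) (hFr n _ (hcm θ).le).continuousAt
          (continuous_circleMap 0 1).continuousAt
    exact (Complex.continuous_im.comp this).div_const _
  have hub : ∀ n θ, 0 ≤ u n θ ∧ u n θ ≤ c := by
    intro n θ
    obtain ⟨h1, h2⟩ := hFb _ (hrn n _ (hcm θ).le)
    refine ⟨by positivity, ?_⟩
    rw [div_le_iff₀ hπ]
    linarith
  set μ : Measure ℝ := volume.restrict (Set.Ioo (-Real.pi) Real.pi) with hμ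
  have : IsFiniteMeasure μ := ⟨by simp [hμ]⟩
  let U : Ultrafilter ℕ := hyperfilter ℕ
  have hU : (U : Filter ℕ) ≤ atTop := Nat.hyperfilter_le_atTop
  obtain ⟨η, hηm, hηb, hη⟩ := exists_weak_limit_of_bounded (μ := μ) U hc
    (fun n => (hucont n).aestronglyMeasurable) hub
  refine ⟨fun t => η (2 * Real.arctan t), by fun_prop, fun t => hηb _, fun z hz => ?_⟩
  set w : ℂ := (Complex.I - z) / (Complex.I + z) with hw
  have hw1 : ‖w‖ < 1 := norm_halfPlaneToDisc_lt hz
  have hwb : w ∈ Metric.ball (0 : ℂ) 1 := by simpa using hw1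
  have hFw : F w = f z := congrArg f (discToHalfPlane_halfPlaneToDisc hz.le)
  have hF0 : F 0 = f Complex.I := by simp [F, discToHalfPlane]
  let k : ℝ → ℂ := fun θ => (circleMap 0 1 θ + w) / (circleMap 0 1 θ - w)
  have hkne : ∀ θ, circleMap 0 1 θ - w ≠ 0 := by
    intro θ h
    rw [sub_eq_zero] at h
    have := hcm θ
    rw [h] at this
    linarith
  have hkc : Continuous k := Continuous.div (by fun_prop) (by fun_prop) hkne
  have hkb : ∀ θ, ‖k θ‖ ≤ 2 / (1 - ‖w‖) := by
    intro θ
    rw [norm_div]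
    have h1 : ‖circleMap 0 1 θ + w‖ ≤ 2 := by
      have := norm_add_le (circleMap 0 1 θ) w
      rw [hcm] at this
      linarith
    have h2 : 1 - ‖w‖ ≤ ‖circleMap 0 1 θ - w‖ := by
      have := norm_sub_norm_le (circleMap 0 1 θ) w
      rwa [hcm] at this
    have h3 : 0 < 1 - ‖w‖ := by linarith
    gcongr
  have hkmem : MemLp k 2 μ := MemLp.of_bound hkc.aestronglyMeasurable _ (Eventually.of_forall hkb)
  have hint : ∀ v : ℝ → ℝ, Measurable v → (∀ θ, 0 ≤ v θ ∧ v θ ≤ c) →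
      Integrable (fun θ => (v θ : ℂ) * k θ) μ := by
    intro v hv hvb
    refine (hkmem.integrable one_le_two).bdd_mul (c := c)
      (Complex.measurable_ofReal.comp hv).aestronglyMeasurable
      (Eventually.of_forall fun θ => ?_)
    rw [Complex.norm_real, Real.norm_of_nonneg (hvb θ).1]
    exact (hvb θ).2
  -- The weak limit is tested against real functions, so the complex kernel is split into real and
  -- imaginary parts.
  have hlim : Tendsto (fun n => ∫ θ, (u n θ : ℂ) * k θ ∂μ) U (𝓝 (∫ θ, (η θ : ℂ) * k θ ∂μ)) := by
    rw [integral_ofReal_mul_eq (hint η hηm hηb)]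
    simp only [integral_ofReal_mul_eq (hint _ (hucont _).measurable (hub _))]
    exact ((Complex.continuous_ofReal.tendsto _).comp (hη _ hkmem.re)).add
      (((Complex.continuous_ofReal.tendsto _).comp (hη _ hkmem.im)).mul_const _)
  have hrep : ∀ n, F ((r n : ℂ) * w) = (F 0).re + Complex.I *
      ((2 : ℂ)⁻¹ * ∫ θ, (u n θ : ℂ) * k θ ∂μ) := by
    intro n
    have hd : DiffContOnCl ℂ (fun ζ => F ((r n : ℂ) * ζ)) (Metric.ball 0 1) := by
      refine DifferentiableOn.diffContOnCl fun ζ hζ => ?_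
      rw [closure_ball _ one_ne_zero, mem_closedBall_zero_iff] at hζ
      exact (hFr n ζ hζ).differentiableWithinAt
    have := hd.eq_re_add_circleAverage_im one_pos hwb
    rw [this, mul_zero, circleAverage_eq_integral_Ioo, Complex.real_smul]
    congr 2
    have e : ∀ θ, (circleMap 0 1 θ + w) / (circleMap 0 1 θ - w) *
        ((F ((r n : ℂ) * circleMap 0 1 θ)).im : ℂ) = (Real.pi : ℂ) * ((u n θ : ℂ) * k θ) := by
      intro θ
      have hπ' : (Real.pi : ℂ) ≠ 0 := Complex.ofReal_ne_zero.2 hπ.ne'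
      simp only [u, k]
      push_cast
      field_simp
    simp only [e, integral_const_mul]
    have hπ' : (Real.pi : ℂ) ≠ 0 := Complex.ofReal_ne_zero.2 hπ.ne'
    push_cast
    field_simp
    rfl
  have hlim2 : Tendsto (fun n => F ((r n : ℂ) * w)) U (𝓝 (F w)) := by
    have h1 : Tendsto (fun n => (r n : ℂ) * w) atTop (𝓝 w) := by
      have := ((Complex.continuous_ofReal.tendsto _).comp hrlim).mul_const w
      simpa using this
    exact ((hF w hw1).continuousAt.tendsto.comp h1).mono_left hU
  have hmain : F w = (F 0).re + Complex.I * ((2 : ℂ)⁻¹ * ∫ θ, (η θ : ℂ) * k θ ∂μ) := by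
    refine tendsto_nhds_unique hlim2 ?_
    simp only [hrep]
    exact ((hlim.const_mul _).const_mul _).const_add _
  -- The Jacobian `2/(1 + t²)` of `θ = 2 arctan t` absorbs the factor `1/2` and turns the Schwarz
  -- kernel into the half-plane kernel.
  rw [← hFw, hmain, hF0, hμ, integral_Ioo_neg_pi_pi_eq, ← mul_assoc, ← integral_const_mul]
  congr 2
  ext t
  rw [← schwarz_kernel_eq hz t, ← circleMap_two_mul_arctan, Complex.real_smul]
  simp only [k, hw]
  push_cast
  ring

/-! ### Fatou's theorem for Poisson integrals on the line. -/

theorem integrableOn_and_integral_Ioi_poisson_weight {a : ℝ} (ha : 0 ≤ a) :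
    IntegrableOn (fun v : ℝ => 2 * v / (1 + v ^ 2) ^ 2) (Set.Ioi a) ∧
      ∫ v in Set.Ioi a, 2 * v / (1 + v ^ 2) ^ 2 = (1 + a ^ 2)⁻¹ := by
  have hd : ∀ v ∈ Set.Ici a, HasDerivAt (fun v : ℝ => -(1 + v ^ 2)⁻¹)
      (2 * v / (1 + v ^ 2) ^ 2) v := by
    intro v _
    have h1 : HasDerivAt (fun v : ℝ => 1 + v ^ 2) (2 * v) v := by
      simpa using (hasDerivAt_pow 2 v).const_add 1
    have := (h1.inv (by positivity)).neg
    exact this.congr_deriv (by ring)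
  have hnn : ∀ v ∈ Set.Ioi a, 0 ≤ 2 * v / (1 + v ^ 2) ^ 2 := by
    intro v hv
    have : 0 ≤ v := ha.trans (le_of_lt hv)
    positivity
  have hlim : Tendsto (fun v : ℝ => -(1 + v ^ 2)⁻¹) atTop (𝓝 0) := by
    have : Tendsto (fun v : ℝ => 1 + v ^ 2) atTop atTop :=
      tendsto_atTop_add_const_left _ _ (tendsto_pow_atTop two_ne_zero)
    simpa using this.inv_tendsto_atTop.neg
  refine ⟨integrableOn_Ioi_deriv_of_nonneg' hd hnn hlim, ?_⟩
  rw [integral_Ioi_of_hasDerivAt_of_nonneg' hd hnn hlim]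
  ring

/-- Exhibits the Poisson kernel as a superposition of indicators of symmetric intervals; the weight
has primitive `-(1 + v²)⁻¹`. -/
theorem integral_Ioi_indicator_poisson_weight (a : ℝ) :
    IntegrableOn (fun v : ℝ => if |a| < v then 2 * v / (1 + v ^ 2) ^ 2 else 0) (Set.Ioi 0) ∧
    ∫ v in Set.Ioi (0 : ℝ), (if |a| < v then 2 * v / (1 + v ^ 2) ^ 2 else 0) = (1 + a ^ 2)⁻¹ := by
  have h := integrableOn_and_integral_Ioi_poisson_weight (abs_nonneg a)
  have e : (fun v : ℝ => if |a| < v then 2 * v / (1 + v ^ 2) ^ 2 else 0) =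
      (Set.Ioi |a|).indicator fun v => 2 * v / (1 + v ^ 2) ^ 2 := by
    ext v
    simp [Set.indicator_apply]
  have e2 : Set.Ioi (0 : ℝ) ∩ Set.Ioi |a| = Set.Ioi |a| :=
    Set.inter_eq_right.2 (Set.Ioi_subset_Ioi (abs_nonneg a))
  constructor
  · rw [e]
    exact ((integrable_indicator_iff measurableSet_Ioi).2 h.1).integrableOn
  · rw [e, setIntegral_indicator measurableSet_Ioi, e2, h.2, sq_abs]

/-- The Poisson integral as an average of means over symmetric intervals. -/
theorem poisson_layer_cake {h : ℝ → ℝ} (hm : Measurable h) {C : ℝ} (hC : ∀ u, |h u| ≤ C) :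
    AEStronglyMeasurable (fun v => 2 * v / (1 + v ^ 2) ^ 2 * ∫ u in (-v)..v, h u)
      (volume.restrict (Set.Ioi (0 : ℝ))) ∧
    ∫ u, h u * (1 + u ^ 2)⁻¹ =
      ∫ v in Set.Ioi (0 : ℝ), 2 * v / (1 + v ^ 2) ^ 2 * ∫ u in (-v)..v, h u := by
  let f : ℝ → ℝ → ℝ := fun u v => h u * (if |u| < v then 2 * v / (1 + v ^ 2) ^ 2 else 0)
  have hfm : Measurable (Function.uncurry f) := by
    refine (hm.comp measurable_fst).mul (Measurable.ite ?_ (by fun_prop) measurable_const)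
    exact measurableSet_lt (by fun_prop) measurable_snd
  have hnorm : ∀ u, ∫ v in Set.Ioi (0 : ℝ), ‖f u v‖ = |h u| * (1 + u ^ 2)⁻¹ := by
    intro u
    have : ∀ v ∈ Set.Ioi (0 : ℝ), ‖f u v‖ =
        |h u| * (if |u| < v then 2 * v / (1 + v ^ 2) ^ 2 else 0) := by
      intro v hv
      have hv' : 0 < v := hv
      simp only [f, norm_mul, Real.norm_eq_abs]
      congr 1
      split_ifs
      · rw [abs_of_nonneg (by positivity)]
      · simp
    rw [setIntegral_congr_fun measurableSet_Ioi this, integral_const_mul,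
      (integral_Ioi_indicator_poisson_weight u).2]
  have hint : Integrable (Function.uncurry f)
      ((volume : Measure ℝ).prod (volume.restrict (Set.Ioi (0 : ℝ)))) := by
    rw [integrable_prod_iff hfm.aestronglyMeasurable]
    refine ⟨Eventually.of_forall fun u => ?_, ?_⟩
    · exact (integral_Ioi_indicator_poisson_weight u).1.const_mul (h u)
    · simp only [Function.uncurry_apply_pair, hnorm]
      refine Integrable.mono' (integrable_inv_one_add_sq.const_mul C)
        (by fun_prop) (Eventually.of_forall fun u => ?_)
      rw [Real.norm_of_nonneg (by positivity)]
      gcongr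
      exact hC u
  have hinner : ∀ v ∈ Set.Ioi (0 : ℝ), ∫ u, f u v =
      2 * v / (1 + v ^ 2) ^ 2 * ∫ u in (-v)..v, h u := by
    intro v hv
    have hv' : 0 < v := hv
    have e : ∀ u, f u v = 2 * v / (1 + v ^ 2) ^ 2 * (Set.Ioo (-v) v).indicator h u := by
      intro u
      simp only [f, Set.indicator_apply, Set.mem_Ioo, ← abs_lt]
      split_ifs <;> ring
    simp only [e]
    rw [integral_const_mul, integral_indicator measurableSet_Ioo,
      intervalIntegral.integral_of_le (by linarith), integral_Ioc_eq_integral_Ioo]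
  constructor
  · refine hint.integral_prod_right.aestronglyMeasurable.congr ?_
    exact (ae_restrict_iff' measurableSet_Ioi).2 (Eventually.of_forall hinner)
  · rw [← setIntegral_congr_fun measurableSet_Ioi hinner, ← integral_integral_swap hint]
    refine integral_congr_ae (Eventually.of_forall fun u => ?_)
    simp only [f]
    rw [integral_const_mul, (integral_Ioi_indicator_poisson_weight u).2]

theorem poisson_integral_rescale (ξ : ℝ → ℝ) (a : ℝ) {ε : ℝ} (hε : 0 < ε) :
    ∫ t, ξ t * (ε / ((t - a) ^ 2 + ε ^ 2)) = ∫ u, ξ (a + ε * u) * (1 + u ^ 2)⁻¹ := by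
  have h1 := integral_add_left_eq_self (μ := (volume : Measure ℝ))
    (fun t => ξ t * (ε / ((t - a) ^ 2 + ε ^ 2))) a
  have h2 := Measure.integral_comp_mul_left
    (fun t => ξ (a + t) * (ε / ((a + t - a) ^ 2 + ε ^ 2))) ε
  rw [← h1]
  rw [abs_of_pos (inv_pos.2 hε), smul_eq_mul, inv_mul_eq_div, eq_div_iff hε.ne'] at h2
  rw [← h2, ← integral_mul_const]
  refine integral_congr_ae (Eventually.of_forall fun u => ?_)
  simp only [add_sub_cancel_left]
  field_simp
  ring

/-- **Fatou's theorem**: Poisson integrals of bounded functions converge to their densities almost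
everywhere. -/
theorem ae_tendsto_poisson_integral {ξ : ℝ → ℝ} (hm : Measurable ξ) {C : ℝ}
    (hC : ∀ t, |ξ t| ≤ C) :
    ∀ᵐ a : ℝ, Tendsto (fun ε => ∫ t, ξ t * (ε / ((t - a) ^ 2 + ε ^ 2))) (𝓝[>] 0)
      (𝓝 (Real.pi * ξ a)) := by
  have hloc : LocallyIntegrable ξ volume :=
    (locallyIntegrable_const C).mono hm.aestronglyMeasurable (Eventually.of_forall fun t => by
      rw [Real.norm_eq_abs]
      exact (hC t).trans (le_abs_self C))
  filter_upwards [LocallyIntegrable.ae_hasDerivAt_integral hloc] with a ha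
  have hii : ∀ x y, IntervalIntegrable ξ volume x y := fun x y =>
    intervalIntegrable_iff.2
      ((hloc.integrableOn_isCompact isCompact_uIcc).mono_set Set.uIoc_subset_uIcc)
  -- The layer-cake formula for the constant function `1` evaluates the limiting integral.
  have hπ : ∫ v in Set.Ioi (0 : ℝ), 2 * v / (1 + v ^ 2) ^ 2 * (2 * v * ξ a) = Real.pi * ξ a := by
    have h1 := (poisson_layer_cake (h := fun _ => 1) measurable_const (C := 1) (by simp)).2
    simp only [one_mul, integral_univ_inv_one_add_sq, intervalIntegral.integral_const] at h1
    rw [h1, ← integral_mul_const]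
    congr 1
    ext v
    simp
    ring
  -- By Lebesgue differentiation the primitive of `ξ` has derivative `ξ a` at `a`. After rescaling,
  -- the mean over `[a - εv, a + εv]` is the difference quotient at `0` of `ε ↦ ∫_{a-εv}^{a+εv} ξ`.
  have hmean : ∀ v : ℝ, Tendsto (fun ε : ℝ => ∫ u in (-v)..v, ξ (a + ε * u)) (𝓝[>] 0)
      (𝓝 (2 * v * ξ a)) := by
    intro v
    have hd1 : HasDerivAt (fun ε : ℝ => a + ε * v) v 0 := by
      simpa using ((hasDerivAt_id (0 : ℝ)).mul_const v).const_add a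
    have hd2 : HasDerivAt (fun ε : ℝ => a + ε * (-v)) (-v) 0 := by
      simpa using ((hasDerivAt_id (0 : ℝ)).mul_const (-v)).const_add a
    have e1 : HasDerivAt (fun x => ∫ t in a..x, ξ t) (ξ a) (a + 0 * v) := by simpa using ha a
    have e2 : HasDerivAt (fun x => ∫ t in a..x, ξ t) (ξ a) (a + 0 * (-v)) := by simpa using ha a
    have h := ((e1.comp (0 : ℝ) hd1).sub (e2.comp (0 : ℝ) hd2)).tendsto_slope_zero_right
    have hval : ξ a * v - ξ a * -v = 2 * v * ξ a := by ring
    rw [hval] at h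
    refine h.congr' ?_
    filter_upwards [self_mem_nhdsWithin] with ε hε
    have hε' : 0 < ε := hε
    rw [intervalIntegral.integral_comp_add_mul _ hε'.ne']
    simp only [Pi.sub_apply, Function.comp_apply, zero_add, zero_mul, add_zero, sub_self, sub_zero,
      intervalIntegral.integral_same]
    rw [intervalIntegral.integral_interval_sub_left (hii _ _) (hii _ _)]
  have hmain : Tendsto (fun ε : ℝ => ∫ v in Set.Ioi (0 : ℝ),
      2 * v / (1 + v ^ 2) ^ 2 * ∫ u in (-v)..v, ξ (a + ε * u)) (𝓝[>] 0)
      (𝓝 (∫ v in Set.Ioi (0 : ℝ), 2 * v / (1 + v ^ 2) ^ 2 * (2 * v * ξ a))) := by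
    refine tendsto_integral_filter_of_dominated_convergence (fun v => 4 * C * (1 + v ^ 2)⁻¹)
      (Eventually.of_forall fun ε =>
        (poisson_layer_cake (h := fun u => ξ (a + ε * u)) (by fun_prop) (fun u => hC _)).1)
      (Eventually.of_forall fun ε =>
        (ae_restrict_iff' measurableSet_Ioi).2 (Eventually.of_forall fun v hv => ?_))
      (integrable_inv_one_add_sq.const_mul _).integrableOn
      (Eventually.of_forall fun v => (hmean v).const_mul _)
    have hv' : 0 < v := hv
    have h1 : ‖∫ u in (-v)..v, ξ (a + ε * u)‖ ≤ C * |v - -v| :=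
      intervalIntegral.norm_integral_le_of_norm_le_const fun u _ => hC _
    rw [sub_neg_eq_add, abs_of_pos (by linarith)] at h1
    have hC0 : 0 ≤ C := (abs_nonneg _).trans (hC 0)
    rw [norm_mul, Real.norm_of_nonneg (by positivity)]
    calc _ ≤ 2 * v / (1 + v ^ 2) ^ 2 * (C * (v + v)) := by gcongr
      _ = 4 * C * (v ^ 2 / (1 + v ^ 2) ^ 2) := by ring
      _ ≤ 4 * C * ((1 + v ^ 2) / (1 + v ^ 2) ^ 2) := by gcongr; linarith
      _ = 4 * C * (1 + v ^ 2)⁻¹ := by field_simp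
  rw [hπ] at hmain
  refine hmain.congr' ?_
  filter_upwards [self_mem_nhdsWithin] with ε hε
  rw [poisson_integral_rescale ξ a hε,
    (poisson_layer_cake (h := fun u => ξ (a + ε * u)) (by fun_prop) (fun u => hC _)).2]

/-! ### Spectral measures and self-adjoint dilations. -/

namespace SpectralFamily

variable {K : Type*} [NormedAddCommGroup K] [InnerProductSpace ℂ K] [CompleteSpace K]

theorem measure_apply (E : SpectralFamily K) (x : K) {s : Set ℝ} (hs : MeasurableSet s) :
    E.measure x s = ENNReal.ofReal (⟪x, E.proj s x⟫_ℂ).re :=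
  Measure.ofMeasurable_apply s hs

instance (E : SpectralFamily K) (x : K) : IsFiniteMeasure (E.measure x) :=
  ⟨by rw [E.measure_apply x MeasurableSet.univ]; exact ENNReal.ofReal_lt_top⟩

theorem measureReal_apply (E : SpectralFamily K) (x : K) {s : Set ℝ} (hs : MeasurableSet s) :
    (E.measure x).real s = (⟪x, E.proj s x⟫_ℂ).re := by
  rw [measureReal_def, E.measure_apply x hs,
    ENNReal.toReal_ofReal (E.re_inner_proj_nonneg x s hs)]

theorem measureReal_univ (E : SpectralFamily K) (x : K) :
    (E.measure x).real Set.univ = ‖x‖ ^ 2 := by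
  rw [E.measureReal_apply x MeasurableSet.univ, E.univ, one_apply_eq_self]
  exact inner_self_eq_norm_sq (𝕜 := ℂ) x

theorem inner_proj (E : SpectralFamily K) (x : K) {s : Set ℝ} (hs : MeasurableSet s) :
    ⟪x, E.proj s x⟫_ℂ = ((E.measure x).real s : ℂ) := by
  rw [E.measureReal_apply x hs]
  apply Complex.ext
  · simp
  · have h1 : ⟪E.proj s x, x⟫_ℂ = ⟪x, E.proj s x⟫_ℂ := by
      have := (E.isStarProjection s hs).isSelfAdjoint
      rw [← ContinuousLinearMap.adjoint_inner_right,
        ContinuousLinearMap.isSelfAdjoint_iff'.mp this]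
    have h2 : (⟪E.proj s x, x⟫_ℂ).im = -(⟪x, E.proj s x⟫_ℂ).im := inner_im_symm (𝕜 := ℂ) _ _
    rw [h1] at h2
    rw [Complex.ofReal_im]
    linarith

end SpectralFamily

/-- The primitive is `arctan (s / |t|)`. The value does not depend on `|t|`, which is why
integrating the resolvent in `s` detects only the sign of `t`. -/
theorem integral_Ioi_abs_div_sq_add_sq {t : ℝ} (ht : t ≠ 0) :
    IntegrableOn (fun s : ℝ => |t| / (t ^ 2 + s ^ 2)) (Set.Ioi 0) ∧
      ∫ s in Set.Ioi (0 : ℝ), |t| / (t ^ 2 + s ^ 2) = Real.pi / 2 := by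
  have ht' : 0 < |t| := abs_pos.2 ht
  have hd : ∀ s ∈ Set.Ici (0 : ℝ), HasDerivAt (fun s : ℝ => Real.arctan (s / |t|))
      (|t| / (t ^ 2 + s ^ 2)) s := by
    intro s _
    have := ((hasDerivAt_id s).div_const |t|).arctan
    refine this.congr_deriv ?_
    simp only [id]
    rw [← sq_abs t]
    field_simp
  have hnn : ∀ s ∈ Set.Ioi (0 : ℝ), 0 ≤ |t| / (t ^ 2 + s ^ 2) := fun s _ => by positivity
  have hlim : Tendsto (fun s : ℝ => Real.arctan (s / |t|)) atTop (𝓝 (Real.pi / 2)) :=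
    (tendsto_nhds_of_tendsto_nhdsWithin Real.tendsto_arctan_atTop).comp
      (tendsto_id.atTop_div_const ht')
  refine ⟨integrableOn_Ioi_deriv_of_nonneg' hd hnn hlim, ?_⟩
  rw [integral_Ioi_of_hasDerivAt_of_nonneg' hd hnn hlim]
  simp

/-- The logarithm as an integral of Cauchy transforms, at the level of the argument. -/
theorem integral_Ioi_integral_div_sq_add_sq (μ : Measure ℝ) [IsFiniteMeasure μ] (h0 : μ {0} = 0) :
    IntegrableOn (fun s : ℝ => ∫ t, t / (t ^ 2 + s ^ 2) ∂μ) (Set.Ioi 0) ∧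
    ∫ s in Set.Ioi (0 : ℝ), ∫ t, t / (t ^ 2 + s ^ 2) ∂μ =
      Real.pi / 2 * μ.real Set.univ - Real.pi * μ.real (Set.Iio 0) := by
  have hne : ∀ᵐ t ∂μ, t ≠ 0 := by
    rw [ae_iff]; simpa using h0
  let f : ℝ → ℝ → ℝ := fun t s => t / (t ^ 2 + s ^ 2)
  have hfm : Measurable (Function.uncurry f) := by
    simp only [Function.uncurry_def, f]
    fun_prop
  have habs : ∀ t s, ‖f t s‖ = |t| / (t ^ 2 + s ^ 2) := by
    intro t s
    rw [Real.norm_eq_abs, abs_div, abs_of_nonneg (by positivity : 0 ≤ t ^ 2 + s ^ 2)]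
  have hint : Integrable (Function.uncurry f) (μ.prod (volume.restrict (Set.Ioi (0 : ℝ)))) := by
    rw [integrable_prod_iff hfm.aestronglyMeasurable]
    constructor
    · filter_upwards [hne] with t ht
      have hft : Measurable (f t) := by
        simp only [f]
        fun_prop
      refine (integrable_norm_iff hft.aestronglyMeasurable).1 ?_
      simp only [habs]
      exact (integral_Ioi_abs_div_sq_add_sq ht).1
    · refine (integrable_const (Real.pi / 2)).congr ?_
      filter_upwards [hne] with t ht
      simp only [Function.uncurry_apply_pair, habs]
      exact (integral_Ioi_abs_div_sq_add_sq ht).2.symm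
  refine ⟨hint.integral_prod_right, ?_⟩
  rw [← integral_integral_swap hint]
  have h1 : ∀ᵐ t ∂μ, ∫ s in Set.Ioi (0 : ℝ), f t s =
      Real.pi / 2 - Real.pi * (Set.Iio (0 : ℝ)).indicator 1 t := by
    filter_upwards [hne] with t ht
    have h2 := (integral_Ioi_abs_div_sq_add_sq ht).2
    rcases lt_or_gt_of_ne ht with h | h
    · have : ∀ s, f t s = -(|t| / (t ^ 2 + s ^ 2)) := by
        intro s; simp only [f]; rw [abs_of_neg h]; ring
      simp only [this, integral_neg, h2]
      rw [Set.indicator_of_mem (by exact h)]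
      simp
      ring
    · have : ∀ s, f t s = |t| / (t ^ 2 + s ^ 2) := by
        intro s; simp only [f]; rw [abs_of_pos h]
      simp only [this, h2]
      rw [Set.indicator_of_notMem (by simpa using h.le)]
      simp
  have hind : Integrable ((Set.Iio (0 : ℝ)).indicator (1 : ℝ → ℝ)) μ :=
    (integrable_indicator_iff measurableSet_Iio).2 (integrable_const (1 : ℝ)).integrableOn
  rw [integral_congr_ae h1, integral_sub (integrable_const _) (hind.const_mul _),
    integral_const_mul, integral_indicator_one measurableSet_Iio, integral_const, smul_eq_mul,
    mul_comm (Real.pi / 2)]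

section Dilation

variable {H K : Type*} [NormedAddCommGroup H] [InnerProductSpace ℂ H] [CompleteSpace H]
  [NormedAddCommGroup K] [InnerProductSpace ℂ K] [CompleteSpace K]

theorem inner_operatorXi (T : H →L[ℂ] H) (x : H) :
    ⟪x, operatorXi T x⟫_ℂ = ((Real.pi⁻¹ * (⟪x, operatorLog T x⟫_ℂ).im : ℝ) : ℂ) := by
  rw [operatorXi, smul_apply, RCLike.real_smul_eq_coe_smul (K := ℂ), inner_smul_right,
    inner_imaginaryPart]
  simp

theorem inner_operatorCompression (J : H →ₗᵢ[ℂ] K) (A : K →L[ℂ] K) (x : H) :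
    ⟪x, operatorCompression J A x⟫_ℂ = ⟪J x, A (J x)⟫_ℂ := by
  simp [operatorCompression, ContinuousLinearMap.adjoint_inner_right]

theorem inv_ofReal_add_I_mul (t s : ℝ) :
    ((t : ℂ) + Complex.I * s)⁻¹ =
      ((t / (t ^ 2 + s ^ 2) : ℝ) : ℂ) + ((-s / (t ^ 2 + s ^ 2) : ℝ) : ℂ) * Complex.I := by
  apply Complex.ext <;>
    simp [-Complex.ofReal_div, Complex.inv_re, Complex.inv_im, Complex.normSq_apply, sq]

/-- The dilation property at `z = -is`, with the Cauchy kernel split into its real part, which gives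
`Im log T`, and its imaginary part, which controls the mass at `0`. -/
theorem IsSelfAdjointDilation.inner_inverse {T : H →L[ℂ] H} {J : H →ₗᵢ[ℂ] K}
    {E : SpectralFamily K} (h : IsSelfAdjointDilation T J E) {s : ℝ} (hs : 0 < s) (x : H) :
    ⟪x, Ring.inverse (T + (Complex.I * (s : ℂ)) • (1 : H →L[ℂ] H)) x⟫_ℂ =
      ((∫ t, t / (t ^ 2 + s ^ 2) ∂(E.measure (J x)) : ℝ) : ℂ) -
        ((∫ t, s / (t ^ 2 + s ^ 2) ∂(E.measure (J x)) : ℝ) : ℂ) * Complex.I := by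
  have h1 := h (-(Complex.I * s)) (by simpa using hs) x
  simp only [neg_smul, sub_neg_eq_add, inv_ofReal_add_I_mul] at h1
  have hbd : ∀ g : ℝ → ℝ, Measurable g → (∀ t, |g t| ≤ (2 * s)⁻¹ + s⁻¹) →
      Integrable g (E.measure (J x)) := fun g hg hb =>
    Integrable.of_bound hg.aestronglyMeasurable _ (Eventually.of_forall hb)
  have i1 : Integrable (fun t => t / (t ^ 2 + s ^ 2)) (E.measure (J x)) := by
    refine hbd _ (by fun_prop) fun t => ?_
    have hs' : 0 ≤ s⁻¹ := by positivity
    have : |t / (t ^ 2 + s ^ 2)| ≤ (2 * s)⁻¹ := by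
      rw [abs_div, abs_of_pos (by positivity : 0 < t ^ 2 + s ^ 2), div_le_iff₀ (by positivity),
        inv_mul_eq_div, le_div_iff₀ (by positivity), ← sq_abs t]
      nlinarith [sq_nonneg (|t| - s)]
    linarith
  have i2 : Integrable (fun t => s / (t ^ 2 + s ^ 2)) (E.measure (J x)) := by
    refine hbd _ (by fun_prop) fun t => ?_
    have hs' : 0 ≤ (2 * s)⁻¹ := by positivity
    have : |s / (t ^ 2 + s ^ 2)| ≤ s⁻¹ := by
      rw [abs_of_nonneg (by positivity), div_le_iff₀ (by positivity), inv_mul_eq_div,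
        le_div_iff₀ (by positivity)]
      nlinarith [sq_nonneg t]
    linarith
  rw [h1, integral_add i1.ofReal, integral_mul_const, integral_complex_ofReal,
    integral_complex_ofReal]
  · simp only [neg_div, integral_neg]
    push_cast
    ring
  · have := i2.neg
    simp only [neg_div]
    exact this.ofReal.mul_const _

/-- An atom at `0` would make `∫ s/(t² + s²) dμ` at least `μ{0}/s`. That integral is `-Im ⟪x, (T +
is)⁻¹ x⟫`, which stays bounded as `s ↓ 0` because `T` is invertible. -/
theorem IsSelfAdjointDilation.measure_singleton_zero {T : H →L[ℂ] H} {J : H →ₗᵢ[ℂ] K}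
    {E : SpectralFamily K} (h : IsSelfAdjointDilation T J E) (hT : IsDissipative T)
    (hu : IsUnit T) (x : H) : E.measure (J x) {0} = 0 := by
  set μ := E.measure (J x) with hμ
  set B : ℝ := 1 + 2 * ‖Ring.inverse T‖
  have hB : 0 ≤ B := by positivity
  have key : ∀ s : ℝ, 0 < s → μ.real {0} ≤ s * (B * ‖x‖ ^ 2) := by
    intro s hs
    have h1 := congrArg Complex.im (h.inner_inverse hs x)
    simp only [Complex.sub_im, Complex.ofReal_im, Complex.mul_im,
      Complex.I_im, Complex.I_re, Complex.ofReal_re, mul_one, mul_zero, add_zero, zero_sub] at h1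
    have h2 : ∫ t, s / (t ^ 2 + s ^ 2) ∂μ ≤ B * ‖x‖ ^ 2 := by
      have h3 : ‖⟪x, Ring.inverse (T + (Complex.I * (s : ℂ)) • (1 : H →L[ℂ] H)) x⟫_ℂ‖ ≤
          ‖x‖ * (B * ‖x‖) := by
        refine (norm_inner_le_norm _ _).trans ?_
        gcongr
        refine (ContinuousLinearMap.le_opNorm _ _).trans ?_
        gcongr
        refine (hT.norm_inverse_add_I_mul_le hu hs.le).trans ?_
        exact div_le_self hB (by linarith)
      have h4 := (abs_le.1 (Complex.abs_im_le_norm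
        ⟪x, Ring.inverse (T + (Complex.I * (s : ℂ)) • (1 : H →L[ℂ] H)) x⟫_ℂ)).1
      nlinarith
    have h5 : μ.real {0} ≤ ∫ t, s * (s / (t ^ 2 + s ^ 2)) ∂μ := by
      rw [← integral_indicator_one (measurableSet_singleton (0 : ℝ))]
      refine integral_mono_of_nonneg (Eventually.of_forall fun t => ?_) ?_
        (Eventually.of_forall fun t => ?_)
      · exact Set.indicator_nonneg (fun _ _ => zero_le_one) t
      · refine Integrable.of_bound (Measurable.aestronglyMeasurable (by fun_prop)) 1
          (Eventually.of_forall fun t => ?_)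
        rw [Real.norm_of_nonneg (by positivity), mul_div_assoc', div_le_one (by positivity)]
        nlinarith [sq_nonneg t]
      · simp only [Set.indicator_apply, Set.mem_singleton_iff]
        split_ifs with h
        · simp only [h, Pi.one_apply]
          rw [zero_pow two_ne_zero, zero_add, mul_div_assoc', ← sq, div_self (by positivity)]
        · positivity
    rw [integral_const_mul] at h5
    exact h5.trans (by gcongr)
  have hlim : Tendsto (fun s : ℝ => s * (B * ‖x‖ ^ 2)) (𝓝[>] 0) (𝓝 0) := by
    have hc : Continuous fun s : ℝ => s * (B * ‖x‖ ^ 2) := by fun_prop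
    simpa using (hc.tendsto 0).mono_left (nhdsWithin_le_nhds (s := Set.Ioi 0))
  have : μ.real {0} ≤ 0 := by
    refine ge_of_tendsto hlim ?_
    filter_upwards [self_mem_nhdsWithin] with s hs using key s hs
  exact (measureReal_eq_zero_iff).1 (le_antisymm this measureReal_nonneg)

/-- Inserting the spectral measure into the formula for `Im log T`, the term `(π/2)‖x‖²` from the
total mass cancels the one from the subtracted `‖x‖²/(1 + s²)`. Only `π μ((-∞, 0))` is left. -/
theorem IsSelfAdjointDilation.operatorXi_eq {T : H →L[ℂ] H} {J : H →ₗᵢ[ℂ] K}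
    {E : SpectralFamily K} (h : IsSelfAdjointDilation T J E) (hT : IsDissipative T)
    (hu : IsUnit T) : operatorXi T = operatorCompression J (E.proj (Set.Iio 0)) := by
  refine ContinuousLinearMap.eq_of_inner_self fun x => ?_
  rw [inner_operatorXi, inner_operatorCompression, E.inner_proj _ measurableSet_Iio]
  congr 1
  obtain ⟨h1, h2⟩ := integral_Ioi_integral_div_sq_add_sq (E.measure (J x))
    (h.measure_singleton_zero hT hu x)
  have h3 : (⟪x, operatorLog T x⟫_ℂ).im =
      -∫ s in Set.Ioi (0 : ℝ), ((∫ t, t / (t ^ 2 + s ^ 2) ∂(E.measure (J x)))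
        - ‖x‖ ^ 2 * (1 + s ^ 2)⁻¹) := by
    rw [hT.im_inner_operatorLog hu]
    congr 1
    refine setIntegral_congr_fun measurableSet_Ioi fun s hs => ?_
    simp only [h.inner_inverse hs x]
    simp
  rw [h3, integral_sub h1 (integrable_inv_one_add_sq.const_mul _).integrableOn, h2,
    integral_const_mul, integral_Ioi_inv_one_add_sq, E.measureReal_univ, J.norm_map]
  have := Real.pi_pos
  simp
  field_simp
  ring

end Dilation

/-! ### Boundary values of scalar Herglotz integrals. -/

/-- The regularised Cauchy kernel of the upper half-plane. -/
noncomputable def herglotzKernel (z : ℂ) (t : ℝ) : ℂ :=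
  ((t : ℂ) - z)⁻¹ - (t : ℂ) * (1 + (t : ℂ) ^ 2)⁻¹

theorem ofReal_sub_ne_zero {z : ℂ} (hz : 0 < z.im) (t : ℝ) : (t : ℂ) - z ≠ 0 := by
  intro h
  have := congrArg Complex.im h
  simp at this
  linarith

theorem one_add_ofReal_sq_ne_zero (t : ℝ) : (1 : ℂ) + (t : ℂ) ^ 2 ≠ 0 := by
  have : (1 : ℝ) + t ^ 2 ≠ 0 := by positivity
  exact_mod_cast this

theorem continuous_herglotzKernel {z : ℂ} (hz : 0 < z.im) : Continuous (herglotzKernel z) :=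
  (Continuous.inv₀ (by fun_prop) (ofReal_sub_ne_zero hz)).sub
    (Continuous.mul (by fun_prop) (Continuous.inv₀ (by fun_prop) one_add_ofReal_sq_ne_zero))

theorem integrable_herglotzKernel {z : ℂ} (hz : 0 < z.im) :
    Integrable (herglotzKernel z) volume := by
  refine Integrable.mono' (integrable_inv_one_add_sq.const_mul (‖1 + z ^ 2‖ / z.im + ‖z‖))
    (continuous_herglotzKernel hz).aestronglyMeasurable (Eventually.of_forall fun t => ?_)
  have h1 := ofReal_sub_ne_zero hz t
  have h2 := one_add_ofReal_sq_ne_zero t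
  -- Factoring out `(1 + t²)⁻¹` leaves a bounded function of `t`, since `|t - z| ≥ Im z`.
  have e : herglotzKernel z t =
      ((1 + z ^ 2) / ((t : ℂ) - z) + z) * ((1 + t ^ 2 : ℝ) : ℂ)⁻¹ := by
    rw [herglotzKernel]
    push_cast
    field_simp
    ring
  rw [e, norm_mul, norm_inv, Complex.norm_real, Real.norm_of_nonneg (by positivity)]
  gcongr
  refine (norm_add_le _ _).trans ?_
  rw [norm_div]
  gcongr
  have := Complex.abs_im_le_norm ((t : ℂ) - z)
  simpa [abs_of_pos hz] using this

/-- The subtracted term is real, so the imaginary part is exactly the Poisson kernel, to which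
Fatou's theorem applies. -/
theorem im_herglotzKernel (a t : ℝ) (ε : ℝ) :
    (herglotzKernel (a + Complex.I * ε) t).im = ε / ((t - a) ^ 2 + ε ^ 2) := by
  have e : (t : ℂ) * (1 + (t : ℂ) ^ 2)⁻¹ = ((t * (1 + t ^ 2)⁻¹ : ℝ) : ℂ) := by push_cast; rfl
  rw [herglotzKernel, e, Complex.sub_im, Complex.ofReal_im, sub_zero, Complex.inv_im]
  simp [Complex.normSq_apply, sq]

theorem integrable_mul_herglotzKernel {ξ : ℝ → ℝ} (hm : Measurable ξ) {C : ℝ}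
    (hC : ∀ t, 0 ≤ ξ t ∧ ξ t ≤ C) {z : ℂ} (hz : 0 < z.im) :
    Integrable (fun t => (ξ t : ℂ) * herglotzKernel z t) volume := by
  refine (integrable_herglotzKernel hz).bdd_mul (c := C)
    (Complex.measurable_ofReal.comp hm).aestronglyMeasurable (Eventually.of_forall fun t => ?_)
  rw [Complex.norm_real, Real.norm_of_nonneg (hC t).1]
  exact (hC t).2

/-- Boundary values of the imaginary part of a function with bounded Herglotz density. -/
theorem ae_tendsto_im_of_representation {f : ℂ → ℂ} {r : ℝ} {ξ : ℝ → ℝ} (hm : Measurable ξ)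
    {C : ℝ} (hC : ∀ t, 0 ≤ ξ t ∧ ξ t ≤ C)
    (hf : ∀ z : ℂ, 0 < z.im → f z = r + ∫ t : ℝ, (ξ t : ℂ) * herglotzKernel z t) :
    ∀ᵐ a : ℝ, Tendsto (fun ε : ℝ => (f ((a : ℂ) + Complex.I * ε)).im) (𝓝[>] 0)
      (𝓝 (Real.pi * ξ a)) := by
  filter_upwards [ae_tendsto_poisson_integral hm (C := C) fun t => by
    rw [abs_of_nonneg (hC t).1]; exact (hC t).2] with a ha
  refine ha.congr' ?_
  filter_upwards [self_mem_nhdsWithin] with ε hε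
  have hz : 0 < ((a : ℂ) + Complex.I * ε).im := by simpa using hε
  have h := integral_im (integrable_mul_herglotzKernel hm hC hz)
  simp only [RCLike.im_eq_complex_im] at h
  rw [hf _ hz, Complex.add_im, Complex.ofReal_im, zero_add, ← h]
  simp only [Complex.im_ofReal_mul, im_herglotzKernel]

/-! ### Existence and uniqueness of the operator-valued density. -/

section Operators

variable {H : Type*} [NormedAddCommGroup H] [InnerProductSpace ℂ H] [CompleteSpace H]

/-- Bounded scalar families converge along an ultrafilter, so all matrix elements converge
simultaneously; the limits form a bounded sesquilinear form, represented by an operator by Riesz. -/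
theorem exists_weak_operator_limit {ι : Type*} (U : Ultrafilter ι) {A : ι → H →L[ℂ] H} {C : ℝ}
    (hA : ∀ n, ‖A n‖ ≤ C) :
    ∃ X : H →L[ℂ] H, ∀ x y, Tendsto (fun n => ⟪x, A n y⟫_ℂ) U (𝓝 ⟪x, X y⟫_ℂ) := by
  have hb : ∀ x y n, ‖⟪x, A n y⟫_ℂ‖ ≤ C * ‖x‖ * ‖y‖ := by
    intro x y n
    calc ‖⟪x, A n y⟫_ℂ‖ ≤ ‖x‖ * ‖A n y‖ := norm_inner_le_norm _ _
      _ ≤ ‖x‖ * (C * ‖y‖) := by gcongr; exact (A n).le_of_opNorm_le (hA n) y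
      _ = _ := by ring
  have hex : ∀ x y, ∃ l : ℂ, Tendsto (fun n => ⟪x, A n y⟫_ℂ) U (𝓝 l) := by
    intro x y
    obtain ⟨l, -, hl⟩ := (isCompact_closedBall (0 : ℂ) (C * ‖x‖ * ‖y‖)).ultrafilter_le_nhds
      (U.map fun n => ⟪x, A n y⟫_ℂ) (by
        rw [le_principal_iff]
        exact Filter.mem_map.2 (Filter.univ_mem' fun n => by simpa using hb x y n))
    exact ⟨l, hl⟩
  choose L hL using hex
  have hLb : ∀ x y, ‖L x y‖ ≤ C * ‖x‖ * ‖y‖ := fun x y =>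
    le_of_tendsto' (hL x y).norm fun n => hb x y n
  let B₀ : H →ₗ⋆[ℂ] H →ₗ[ℂ] ℂ := LinearMap.mk₂'ₛₗ (starRingEnd ℂ) (RingHom.id ℂ) L
    (fun a b y => tendsto_nhds_unique (hL (a + b) y) (by
      simpa only [inner_add_left] using (hL a y).add (hL b y)))
    (fun c a y => tendsto_nhds_unique (hL (c • a) y) (by
      simpa only [inner_smul_left, smul_eq_mul] using (hL a y).const_mul ((starRingEnd ℂ) c)))
    (fun a y z => tendsto_nhds_unique (hL a (y + z)) (by
      simpa only [map_add, inner_add_right] using (hL a y).add (hL a z)))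
    (fun c a y => tendsto_nhds_unique (hL a (c • y)) (by
      simpa only [map_smul, inner_smul_right, smul_eq_mul, RingHom.id_apply] using
        (hL a y).const_mul c))
  let B : H →L⋆[ℂ] H →L[ℂ] ℂ := B₀.mkContinuous₂ C hLb
  refine ⟨ContinuousLinearMap.adjoint (InnerProductSpace.continuousLinearMapOfBilin B),
    fun x y => ?_⟩
  rw [ContinuousLinearMap.adjoint_inner_right, InnerProductSpace.continuousLinearMapOfBilin_apply]
  exact hL x y

theorem nonneg_and_le_one_of_inner {X : H →L[ℂ] H}
    (h : ∀ x, ∃ q : ℝ, ⟪x, X x⟫_ℂ = q ∧ 0 ≤ q ∧ q ≤ ‖x‖ ^ 2) : 0 ≤ X ∧ X ≤ 1 := by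
  constructor
  · rw [ContinuousLinearMap.nonneg_iff_inner]
    intro x
    obtain ⟨q, h1, h2, h3⟩ := h x
    simp [h1, h2]
  · rw [← sub_nonneg, ContinuousLinearMap.nonneg_iff_inner]
    intro x
    obtain ⟨q, h1, h2, h3⟩ := h x
    have : ⟪x, ((1 : H →L[ℂ] H) - X) x⟫_ℂ = ((‖x‖ ^ 2 - q : ℝ) : ℂ) := by
      rw [sub_apply, inner_sub_right, h1, one_apply_eq_self, inner_self_eq_norm_sq_to_K]
      simp
    rw [this, Complex.ofReal_re, Complex.ofReal_im]
    exact ⟨sub_nonneg.2 h3, rfl⟩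

theorem inner_of_nonneg_of_le_one {X : H →L[ℂ] H} (h : 0 ≤ X ∧ X ≤ 1) (x : H) :
    ⟪x, X x⟫_ℂ = ((⟪x, X x⟫_ℂ).re : ℂ) ∧ 0 ≤ (⟪x, X x⟫_ℂ).re ∧ (⟪x, X x⟫_ℂ).re ≤ ‖x‖ ^ 2 := by
  have h1 := (ContinuousLinearMap.nonneg_iff_inner X).1 h.1 x
  have h2 := (ContinuousLinearMap.nonneg_iff_inner _).1 (sub_nonneg.2 h.2) x
  refine ⟨Complex.ext (by simp) (by simp [h1.2]), h1.1, ?_⟩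
  have h3 : (⟪x, x⟫_ℂ).re = ‖x‖ ^ 2 := inner_self_eq_norm_sq (𝕜 := ℂ) x
  have h4 := h2.1
  rw [sub_apply, inner_sub_right, one_apply_eq_self, Complex.sub_re, h3] at h4
  linarith

theorem operatorXi_nonneg_and_le_one {T : H →L[ℂ] H} (hT : IsDissipative T) (hu : IsUnit T) :
    0 ≤ operatorXi T ∧ operatorXi T ≤ 1 := by
  refine nonneg_and_le_one_of_inner fun x => ⟨_, inner_operatorXi T x, ?_, ?_⟩
  · have := hT.operatorLog hu x
    have := Real.pi_pos
    positivity
  · rw [inv_mul_le_iff₀ Real.pi_pos]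
    exact hT.im_inner_operatorLog_le hu x

theorem ContinuousLinearMap.inner_polarization (A : H →L[ℂ] H) (x y : H) :
    ⟪x, A y⟫_ℂ = (⟪x + y, A (x + y)⟫_ℂ - ⟪x - y, A (x - y)⟫_ℂ
      - Complex.I * ⟪x + Complex.I • y, A (x + Complex.I • y)⟫_ℂ
      + Complex.I * ⟪x - Complex.I • y, A (x - Complex.I • y)⟫_ℂ) / 4 := by
  have h := congrArg (starRingEnd ℂ) (inner_map_polarization (A : H →ₗ[ℂ] H) x y)
  simp only [ContinuousLinearMap.coe_coe, inner_conj_symm] at h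
  rw [h, map_div₀, map_sub, map_add, map_sub, map_mul, map_mul]
  simp only [inner_conj_symm, Complex.conj_I, map_ofNat]
  ring

/-- It suffices to check the defining properties of an exponential Herglotz density on the
diagonal. -/
theorem isExponentialHerglotzDensity_of_diagonal {M : ℂ → H →L[ℂ] H} {X : ℝ → H →L[ℂ] H}
    (hX : ∀ t, 0 ≤ X t ∧ X t ≤ 1)
    (hm : ∀ x, AEMeasurable (fun t => ⟪x, X t x⟫_ℂ) volume)
    (hint : ∀ z : ℂ, 0 < z.im → ∀ x,
      Integrable (fun t : ℝ => ⟪x, X t x⟫_ℂ * herglotzKernel z t) volume)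
    (hrep : ∀ z : ℂ, 0 < z.im → ∀ x, ⟪x, operatorLog (M z) x⟫_ℂ =
      ⟪x, (ℜ (operatorLog (M Complex.I)) : H →L[ℂ] H) x⟫_ℂ
        + ∫ t : ℝ, ⟪x, X t x⟫_ℂ * herglotzKernel z t) :
    IsExponentialHerglotzDensity M X := by
  refine ⟨fun t => (((ContinuousLinearMap.nonneg_iff_isPositive _).1 (hX t).1).isSelfAdjoint),
    fun x y => ?_, Eventually.of_forall hX, fun z hz x y => ?_, fun z hz x y => ?_⟩
  · simp only [ContinuousLinearMap.inner_polarization _ x y]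
    exact ((((hm _).sub (hm _)).sub ((hm _).const_mul _)).add ((hm _).const_mul _)).div_const _
  · have : (fun t : ℝ => ⟪x, X t y⟫_ℂ * herglotzKernel z t) = fun t =>
        (⟪x + y, X t (x + y)⟫_ℂ * herglotzKernel z t - ⟪x - y, X t (x - y)⟫_ℂ * herglotzKernel z t
      - Complex.I * (⟪x + Complex.I • y, X t (x + Complex.I • y)⟫_ℂ * herglotzKernel z t)
      + Complex.I * (⟪x - Complex.I • y, X t (x - Complex.I • y)⟫_ℂ * herglotzKernel z t)) / 4 := by
      ext t
      rw [ContinuousLinearMap.inner_polarization (X t) x y]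
      ring
    change Integrable (fun t : ℝ => ⟪x, X t y⟫_ℂ * herglotzKernel z t) volume
    rw [this]
    exact ((((hint z hz _).sub (hint z hz _)).sub ((hint z hz _).const_mul _)).add
      ((hint z hz _).const_mul _)).div_const _
  · have : (fun t : ℝ => ⟪x, X t y⟫_ℂ * herglotzKernel z t) = fun t =>
        (⟪x + y, X t (x + y)⟫_ℂ * herglotzKernel z t - ⟪x - y, X t (x - y)⟫_ℂ * herglotzKernel z t
      - Complex.I * (⟪x + Complex.I • y, X t (x + Complex.I • y)⟫_ℂ * herglotzKernel z t)
      + Complex.I * (⟪x - Complex.I • y, X t (x - Complex.I • y)⟫_ℂ * herglotzKernel z t)) / 4 := by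
      ext t
      rw [ContinuousLinearMap.inner_polarization (X t) x y]
      ring
    change _ = _ + ∫ t : ℝ, ⟪x, X t y⟫_ℂ * herglotzKernel z t
    rw [this, integral_div, integral_add, integral_sub, integral_sub, integral_const_mul,
      integral_const_mul, ContinuousLinearMap.inner_polarization (operatorLog (M z)) x y,
      ContinuousLinearMap.inner_polarization (ℜ (operatorLog (M Complex.I)) : H →L[ℂ] H) x y,
      hrep z hz (x + y), hrep z hz (x - y), hrep z hz (x + Complex.I • y),
      hrep z hz (x - Complex.I • y)]
    · ring
    · exact hint z hz _
    · exact hint z hz _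
    · exact (hint z hz _).sub (hint z hz _)
    · exact (hint z hz _).const_mul _
    · exact ((hint z hz _).sub (hint z hz _)).sub ((hint z hz _).const_mul _)
    · exact (hint z hz _).const_mul _

theorem tendsto_one_div_add_one_nhdsGT :
    Tendsto (fun n : ℕ => 1 / ((n : ℝ) + 1)) atTop (𝓝[>] 0) :=
  tendsto_nhdsWithin_iff.2 ⟨tendsto_one_div_add_atTop_nhds_zero_nat,
    Eventually.of_forall fun n => by
      have : 0 < 1 / ((n : ℝ) + 1) := by positivity
      exact this⟩

/-- The scalar densities `ξ_x` are determined only up to null sets depending on `x`, so they cannot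
be polarized directly into operators. Instead `X t` is defined for every `t` as an ultrafilter limit
of `Ξ(M)` along a vertical approach, and is compared with each `ξ_x` afterwards. -/
theorem IsOperatorHerglotz.exists_exponentialHerglotzDensity {M : ℂ → H →L[ℂ] H}
    (hM : IsOperatorHerglotz M) (hu : ∀ z : ℂ, 0 < z.im → IsUnit (M z)) :
    ∃ X : ℝ → H →L[ℂ] H, IsExponentialHerglotzDensity M X := by
  let U : Ultrafilter ℕ := hyperfilter ℕ
  have hU : (U : Filter ℕ) ≤ atTop := Nat.hyperfilter_le_atTop
  let p : ℝ → ℕ → ℂ := fun t n => (t : ℂ) + Complex.I * ((1 / ((n : ℝ) + 1) : ℝ) : ℂ)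
  have hp : ∀ t n, 0 < (p t n).im := by
    intro t n
    have : 0 < 1 / ((n : ℝ) + 1) := by positivity
    simpa only [p, Complex.add_im, Complex.ofReal_im, Complex.I_mul_im, Complex.ofReal_re,
      zero_add] using this
  have hXi : ∀ t n, 0 ≤ operatorXi (M (p t n)) ∧ operatorXi (M (p t n)) ≤ 1 := fun t n =>
    operatorXi_nonneg_and_le_one (hM.isDissipative (hp t n)) (hu _ (hp t n))
  have hnorm : ∀ t n, ‖operatorXi (M (p t n))‖ ≤ 2 * 1 := by
    intro t n
    refine ContinuousLinearMap.opNorm_le_of_inner_self _ zero_le_one fun x => ?_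
    obtain ⟨h1, h2, h3⟩ := inner_of_nonneg_of_le_one (hXi t n) x
    rw [h1, Complex.norm_real, Real.norm_of_nonneg h2]
    simpa using h3
  choose X hX using fun t => exists_weak_operator_limit U (hnorm t)
  have hXq : ∀ t x, Tendsto (fun n => Real.pi⁻¹ * (⟪x, operatorLog (M (p t n)) x⟫_ℂ).im) U
      (𝓝 (⟪x, X t x⟫_ℂ).re) := by
    intro t x
    have := (Complex.continuous_re.tendsto _).comp (hX t x x)
    simpa only [Function.comp_def, inner_operatorXi, Complex.ofReal_re] using this
  have hX01 : ∀ t, 0 ≤ X t ∧ X t ≤ 1 := by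
    intro t
    refine nonneg_and_le_one_of_inner fun x => ⟨(⟪x, X t x⟫_ℂ).re, ?_, ?_, ?_⟩
    · have := (Complex.continuous_im.tendsto _).comp (hX t x x)
      simp only [Function.comp_def, inner_operatorXi, Complex.ofReal_im] at this
      have h0 := tendsto_nhds_unique this tendsto_const_nhds
      exact Complex.ext (by simp) (by simpa using h0)
    · refine ge_of_tendsto' (hXq t x) fun n => ?_
      have := (hM.isDissipative (hp t n)).operatorLog (hu _ (hp t n)) x
      have := Real.pi_pos
      positivity
    · refine le_of_tendsto' (hXq t x) fun n => ?_
      rw [inv_mul_le_iff₀ Real.pi_pos]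
      exact (hM.isDissipative (hp t n)).im_inner_operatorLog_le (hu _ (hp t n)) x
  have hdiag : ∀ x : H, ∃ ξ : ℝ → ℝ, Measurable ξ ∧ (∀ t, 0 ≤ ξ t ∧ ξ t ≤ ‖x‖ ^ 2) ∧
      (∀ z : ℂ, 0 < z.im → ⟪x, operatorLog (M z) x⟫_ℂ =
        ⟪x, (ℜ (operatorLog (M Complex.I)) : H →L[ℂ] H) x⟫_ℂ
          + ∫ t : ℝ, (ξ t : ℂ) * herglotzKernel z t) ∧
      (fun t => ⟪x, X t x⟫_ℂ) =ᵐ[volume] fun t => (ξ t : ℂ) := by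
    intro x
    have hfd : DifferentiableOn ℂ (fun z => ⟪x, operatorLog (M z) x⟫_ℂ) {z : ℂ | 0 < z.im} := by
      intro z hz
      exact (((innerSL ℂ x).comp (ContinuousLinearMap.apply ℂ H x)).differentiableAt.comp z
        (differentiableAt_operatorLog_comp hM hu hz)).differentiableWithinAt
    obtain ⟨ξ, hξm, hξb, hξ⟩ := exists_density_of_im_bounded hfd (sq_nonneg ‖x‖)
      fun z hz => ⟨(hM.isDissipative hz).operatorLog (hu z hz) x,
        (hM.isDissipative hz).im_inner_operatorLog_le (hu z hz) x⟩
    refine ⟨ξ, hξm, hξb, fun z hz => ?_, ?_⟩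
    · rw [inner_realPart]
      exact hξ z hz
    -- Where the vertical limit exists in the ordinary sense, the ultrafilter limit must coincide
    -- with it.
    · filter_upwards [ae_tendsto_im_of_representation hξm hξb hξ] with t ht
      have h1 := ((ht.comp tendsto_one_div_add_one_nhdsGT).const_mul Real.pi⁻¹).mono_left hU
      rw [inv_mul_cancel_left₀ Real.pi_pos.ne'] at h1
      have h2 := tendsto_nhds_unique (hXq t x) h1
      rw [(inner_of_nonneg_of_le_one (hX01 t) x).1, h2]
  choose ξ hξm hξb hξ hae using hdiag
  have hae' : ∀ z x, (fun t => ⟪x, X t x⟫_ℂ * herglotzKernel z t) =ᵐ[volume]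
      fun t => (ξ x t : ℂ) * herglotzKernel z t := fun z x => by
    filter_upwards [hae x] with t ht
    rw [ht]
  refine ⟨X, isExponentialHerglotzDensity_of_diagonal hX01 (fun x => ?_) (fun z hz x => ?_)
    fun z hz x => ?_⟩
  · exact ⟨_, Complex.measurable_ofReal.comp (hξm x), hae x⟩
  · exact (integrable_mul_herglotzKernel (hξm x) (hξb x) hz).congr (hae' z x).symm
  · rw [hξ x z hz, integral_congr_ae (hae' z x)]

/-- Holds for an arbitrary density, not just the constructed one, and thereby forces its values. -/
theorem IsExponentialHerglotzDensity.ae_tendsto_im_inner {M : ℂ → H →L[ℂ] H}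
    {X : ℝ → H →L[ℂ] H} (hX : IsExponentialHerglotzDensity M X) (x : H) :
    ∀ᵐ a : ℝ, Tendsto
      (fun ε : ℝ => (⟪x, operatorLog (M ((a : ℂ) + Complex.I * ε)) x⟫_ℂ).im) (𝓝[>] 0)
      (𝓝 (Real.pi * (⟪x, X a x⟫_ℂ).re)) := by
  have hm : AEMeasurable (fun t => (⟪x, X t x⟫_ℂ).re) volume :=
    Complex.measurable_re.comp_aemeasurable (hX.weaklyMeasurable x x)
  -- A Borel modification of `t ↦ ⟪x, X t x⟫`, truncated to be bounded everywhere, as the boundary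
  -- value theorem requires.
  let ξ : ℝ → ℝ := fun t => max 0 (min (‖x‖ ^ 2) (hm.mk _ t))
  have hξm : Measurable ξ := measurable_const.max (measurable_const.min hm.measurable_mk)
  have hξb : ∀ t, 0 ≤ ξ t ∧ ξ t ≤ ‖x‖ ^ 2 := fun t =>
    ⟨le_max_left _ _, max_le (sq_nonneg _) (min_le_left _ _)⟩
  have hae : ∀ᵐ t, ⟪x, X t x⟫_ℂ = (ξ t : ℂ) := by
    filter_upwards [hm.ae_eq_mk, hX.nonneg_le_one] with t h1 h2
    obtain ⟨h3, h4, h5⟩ := inner_of_nonneg_of_le_one h2 x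
    simp only [ξ]
    rw [← h1, min_eq_right h5, max_eq_right h4]
    exact h3
  have hrep : ∀ z : ℂ, 0 < z.im → ⟪x, operatorLog (M z) x⟫_ℂ =
      ((⟪x, operatorLog (M Complex.I) x⟫_ℂ).re : ℂ)
        + ∫ t : ℝ, (ξ t : ℂ) * herglotzKernel z t := by
    intro z hz
    rw [hX.representation z hz x x, inner_realPart]
    congr 1
    refine integral_congr_ae ?_
    filter_upwards [hae] with t ht
    rw [ht]
    rfl
  filter_upwards [ae_tendsto_im_of_representation hξm hξb hrep, hae] with a h1 h2
  rw [h2, Complex.ofReal_re]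
  exact h1

/-- The exceptional set in Fatou's theorem depends on the vector. A countable dense sequence gives a
single null set, off which the two continuous quadratic forms agree on a dense set and hence
everywhere. -/
theorem IsExponentialHerglotzDensity.ae_eq_operatorXi [TopologicalSpace.SeparableSpace H]
    {M : ℂ → H →L[ℂ] H} (hM : IsOperatorHerglotz M) {X : ℝ → H →L[ℂ] H}
    (hX : IsExponentialHerglotzDensity M X) (M₀ : ℝ → H →L[ℂ] H) :
    ∀ᵐ t : ℝ, Tendsto (fun ε : ℝ => M ((t : ℂ) + Complex.I * (ε : ℂ))) (𝓝[>] 0) (𝓝 (M₀ t)) →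
      IsDissipative (M₀ t) → IsUnit (M₀ t) → X t = operatorXi (M₀ t) := by
  have hall : ∀ᵐ a : ℝ, ∀ n : ℕ, Tendsto (fun ε : ℝ =>
      (⟪TopologicalSpace.denseSeq H n, operatorLog (M ((a : ℂ) + Complex.I * ε))
        (TopologicalSpace.denseSeq H n)⟫_ℂ).im) (𝓝[>] 0)
      (𝓝 (Real.pi * (⟪TopologicalSpace.denseSeq H n, X a
        (TopologicalSpace.denseSeq H n)⟫_ℂ).re)) :=
    ae_all_iff.2 fun n => hX.ae_tendsto_im_inner _
  filter_upwards [hall, hX.nonneg_le_one] with t ht h01 hlim hd hu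
  have hlog := tendsto_operatorLog hd hu (by
    filter_upwards [self_mem_nhdsWithin] with ε hε
    exact hM.isDissipative (by simpa using hε)) hlim
  refine ContinuousLinearMap.eq_of_inner_self fun x => ?_
  have hc : ∀ A : H →L[ℂ] H, Continuous fun x => ⟪x, A x⟫_ℂ := fun A => by fun_prop
  refine congrFun (Continuous.ext_on (TopologicalSpace.denseRange_denseSeq H) (hc (X t))
    (hc (operatorXi (M₀ t))) ?_) x
  rintro _ ⟨n, rfl⟩
  have hcA : Continuous fun A : H →L[ℂ] H =>
      (⟪TopologicalSpace.denseSeq H n, A (TopologicalSpace.denseSeq H n)⟫_ℂ).im := by fun_prop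
  have h1 := tendsto_nhds_unique (ht n) ((hcA.tendsto _).comp hlog)
  simp only
  rw [inner_operatorXi, ← h1, inv_mul_cancel_left₀ Real.pi_pos.ne']
  exact (inner_of_nonneg_of_le_one h01 _).1

end Operators

/-! ### The main theorem. -/

theorem theoremt5 {H : Type*} [NormedAddCommGroup H] [InnerProductSpace ℂ H] [CompleteSpace H]
    [TopologicalSpace.SeparableSpace H]
    (M : ℂ → H →L[ℂ] H) (hM : IsOperatorHerglotz M)
    (hinv : ∃ z₀ : ℂ, 0 < z₀.im ∧ IsUnit (M z₀)) :
    (∀ z : ℂ, 0 < z.im → IsUnit (M z)) ∧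
    (∃ X : ℝ → H →L[ℂ] H, IsExponentialHerglotzDensity M X) ∧
    (∀ X : ℝ → H →L[ℂ] H, IsExponentialHerglotzDensity M X →
      ∀ (Λ : Set ℝ), NullMeasurableSet Λ volume → volume Λ ≠ 0 →
      ∀ (M₀ : ℝ → H →L[ℂ] H),
        (∀ᵐ t ∂(volume : Measure ℝ), t ∈ Λ →
          Tendsto (fun ε : ℝ => M ((t : ℂ) + Complex.I * (ε : ℂ))) (𝓝[>] 0) (𝓝 (M₀ t))) →
        (∀ᵐ t ∂(volume : Measure ℝ), t ∈ Λ → 0 ≤ (ℑ (M₀ t) : H →L[ℂ] H) ∧ IsUnit (M₀ t)) →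
        (∀ᵐ t ∂(volume : Measure ℝ), t ∈ Λ →
          X t = operatorXi (M₀ t) ∧
          ∀ (K : Type*) [NormedAddCommGroup K] [InnerProductSpace ℂ K] [CompleteSpace K]
            (J : H →ₗᵢ[ℂ] K) (E : SpectralFamily K), IsSelfAdjointDilation (M₀ t) J E →
            X t = operatorCompression J (E.proj (Set.Iio 0)))) := by
  have hu : ∀ z : ℂ, 0 < z.im → IsUnit (M z) := fun z hz => hM.isUnit hinv hz
  refine ⟨hu, hM.exists_exponentialHerglotzDensity hu, fun X hX Λ _ _ M₀ hlim hM₀ => ?_⟩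
  filter_upwards [hX.ae_eq_operatorXi hM M₀, hlim, hM₀] with t h1 h2 h3 ht
  have hd : IsDissipative (M₀ t) := (imaginaryPart_nonneg_iff _).1 (h3 ht).1
  have hXt := h1 (h2 ht) hd (h3 ht).2
  exact ⟨hXt, fun K _ _ _ J E hJ => hXt.trans (hJ.operatorXi_eq hd (h3 ht).2)⟩
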